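/- Let $A=\mathbb{Q}[x,y,z,a,b,c,d]$ with its standard grading, let $I=(xyab,\;xzcd,\;yz(ab-cd))\subset A$, and let $f=xyzabcd(ab-cd)$, a form of degree $9$. For $n\ge 1$ let $I^{(n)}=\bigcap_{\mathfrak p\in \mathrm{Ass}(A/I)}(I^nA_{\mathfrak p}\cap A)$ denote the $n$-th symbolic power of $I$. Then: 1. $I$ is a radical ideal; 2. $I$ is binomial, i.e. generated by polynomials with at most two terms; 3. $A/I$ is a Cohen–Macaulay ring and $I$ has height $2$; 4. $I$ is generated by forms of degree $4$; 5. $I^{(2)}=I^2+(f)$, and $f$ is a minimal generator of $I^{(2)}$ of degree $9$, i.e. $f$ belongs to a system of homogeneous generators of $I^{(2)}$ from which no element can be omitted; 6. consequently $I^{(2)}$ is not generated by forms of degrees at most $8=2\cdot 4$. Thus the bound "if $I$ is generated in degrees $\le D$, then $I^{(2)}$ is generated in degrees $\le 2D$" fails for the radical ideal $I$ (with $D=4$). -/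

import Mathlib

open MvPolynomial

noncomputable section

/-- The `n`-th symbolic power `I^(n) = ⋂_{p ∈ Ass(A/I)} (I^n A_p ∩ A)`. -/
def symbolicPower {A : Type*} [CommRing A] (I : Ideal A) (n : ℕ) : Ideal A :=
  ⨅ p : associatedPrimes A (A ⧸ I),
    ((I ^ n).map (algebraMap A (Localization.AtPrime p.1))).comap
      (algebraMap A (Localization.AtPrime p.1))

/-- The depth of a local ring: the supremum of the lengths of the regular sequences that are
contained in its maximal ideal. -/
def localRingDepth (R : Type*) [CommRing R] [IsLocalRing R] : ℕ∞ :=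
  ⨆ (rs : List R) (_ : (∀ r ∈ rs, r ∈ IsLocalRing.maximalIdeal R) ∧
    RingTheory.Sequence.IsRegular R rs), (rs.length : ℕ∞)

/-- A commutative ring is Cohen-Macaulay if it is Noetherian and its localization at every maximal
ideal has depth equal to its Krull dimension. -/
structure IsCohenMacaulayRing (R : Type*) [CommRing R] : Prop where
  isNoetherianRing : IsNoetherianRing R
  depth_eq_dim : ∀ (m : Ideal R) [m.IsMaximal],
    (localRingDepth (Localization.AtPrime m) : WithBot ℕ∞) =
      ringKrullDim (Localization.AtPrime m)

section Polynomial

variable {σ K : Type*} [Field K]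

/-- An ideal of a polynomial ring is binomial if it is generated by polynomials with at most two
terms. -/
def IsBinomialIdeal (I : Ideal (MvPolynomial σ K)) : Prop :=
  ∃ S : Set (MvPolynomial σ K), (∀ g ∈ S, g.support.card ≤ 2) ∧ Ideal.span S = I

/-- The ideal is generated by forms of degree `d` (for the standard grading). -/
def IsGeneratedInDegree (I : Ideal (MvPolynomial σ K)) (d : ℕ) : Prop :=
  ∃ S : Set (MvPolynomial σ K), (∀ g ∈ S, g.IsHomogeneous d) ∧ Ideal.span S = I

/-- The ideal is generated by forms of degrees at most `D` (for the standard grading). -/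
def IsGeneratedInDegreesLE (I : Ideal (MvPolynomial σ K)) (D : ℕ) : Prop :=
  ∃ S : Set (MvPolynomial σ K), (∀ g ∈ S, ∃ d ≤ D, g.IsHomogeneous d) ∧ Ideal.span S = I

/-- `f` is a minimal generator of the ideal `J`: it belongs to a system of homogeneous generators
of `J` from which no element can be omitted. -/
def IsMinimalGenerator (f : MvPolynomial σ K) (J : Ideal (MvPolynomial σ K)) : Prop :=
  ∃ S : Set (MvPolynomial σ K), f ∈ S ∧ (∀ g ∈ S, ∃ d, g.IsHomogeneous d) ∧
    Ideal.span S = J ∧ ∀ g ∈ S, Ideal.span (S \ {g}) ≠ J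

end Polynomial

/-- The ideal `(xyab, xzcd, yz(ab - cd))` of `ℚ[x, y, z, a, b, c, d]`; the variables
`x, y, z, a, b, c, d` are `X 0, …, X 6`, in this order. -/
def exampleIdeal : Ideal (MvPolynomial (Fin 7) ℚ) :=
  let x : MvPolynomial (Fin 7) ℚ := X 0
  let y : MvPolynomial (Fin 7) ℚ := X 1
  let z : MvPolynomial (Fin 7) ℚ := X 2
  let a : MvPolynomial (Fin 7) ℚ := X 3
  let b : MvPolynomial (Fin 7) ℚ := X 4
  let c : MvPolynomial (Fin 7) ℚ := X 5
  let d : MvPolynomial (Fin 7) ℚ := X 6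
  Ideal.span {x * y * a * b, x * z * c * d, y * z * (a * b - c * d)}

/-- The polynomial `xyzabcd(ab - cd)`, with the variables named as in `exampleIdeal`. -/
def exampleForm : MvPolynomial (Fin 7) ℚ :=
  let x : MvPolynomial (Fin 7) ℚ := X 0
  let y : MvPolynomial (Fin 7) ℚ := X 1
  let z : MvPolynomial (Fin 7) ℚ := X 2
  let a : MvPolynomial (Fin 7) ℚ := X 3
  let b : MvPolynomial (Fin 7) ℚ := X 4
  let c : MvPolynomial (Fin 7) ℚ := X 5
  let d : MvPolynomial (Fin 7) ℚ := X 6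
  x * y * z * a * b * c * d * (a * b - c * d)

end

/-!
Write `w = ab - cd`, `I = exampleIdeal` and `f = xyzabcd w`.

The ideal `I` is the intersection of twelve primes `(p, q)`, each generated by two prime elements
(`IsComponentPair`, `mem_exampleIdeal_of_forall`); hence it is radical, and every prime that
contains it has height at least `2`.

*Symbolic square.* At each of the twelve primes, `I ^ 2` lies in `(p, q) ^ 2`, and `p, q` is a
regular sequence, so an element of the symbolic square that is `e p + g q` modulo `(p, q) ^ 2` has
`e, g ∈ (p, q)` (`mem_span_of_mem_symbolicPower`). These conditions put an element of the symbolic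
square, modulo `I ^ 2`, into the form `xyz(α ab + β cd)`, then `xyzabcd δ`, and finally `δ' f`
(`exists_eq_xyz_mul_add`, `exists_eq_xyzabcd_mul_add`, `symbolicPower_exampleIdeal_two_le`).
Conversely `xf`, `yf` and `zf` lie in `I ^ 2`, and no associated prime of `I` contains `x`, `y` and
`z` (`exampleForm_mem_symbolicPower`).

*Cohen-Macaulayness.* Let `A` be the polynomial ring and `B` the subring generated by
`a - y, b - y, c - z, d + z, x + y - z`. Multiplication by `x` gives an exact sequence
`0 → A/(yab, zcd) → A/I → A/(x, yzw) → 0`. Its ends are obtained from `B` by adjoining roots of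
monic polynomials, so they are free over `B`, and so is `A/I` (`free_quotient_exampleIdeal`). A
maximal ideal `m` of `A/I` contains a monic polynomial in each of the five parameters; these
polynomials form a regular sequence in `B`, hence by flatness in `A/I`. Its length `5` is the
maximum allowed by the dimension of `A/I` (`isCohenMacaulayRing_of_flat`).

*Generators.* Points with values in rings with square-zero elements separate each of the six
products of generators of `I`, and `f`, from the remaining elements among them
(`exists_separating_hom`, `exampleForm_notMem_sq_exampleIdeal`). As `f ∉ I ^ 2` and `I ^ 2` is
homogeneous, the forms of degree at most `8` in `I ^ 2 + (f)` lie in `I ^ 2` and do not generate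
it.
-/

local notation "𝐱" => (X 0 : MvPolynomial (Fin 7) ℚ)
local notation "𝐲" => (X 1 : MvPolynomial (Fin 7) ℚ)
local notation "𝐳" => (X 2 : MvPolynomial (Fin 7) ℚ)
local notation "𝐚" => (X 3 : MvPolynomial (Fin 7) ℚ)
local notation "𝐛" => (X 4 : MvPolynomial (Fin 7) ℚ)
local notation "𝐜" => (X 5 : MvPolynomial (Fin 7) ℚ)
local notation "𝐝" => (X 6 : MvPolynomial (Fin 7) ℚ)
local notation "𝐰" => (𝐚 * 𝐛 - 𝐜 * 𝐝)

/-! ### Ideals generated by two elements -/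

section Pairs

variable {R : Type*} [CommRing R]

theorem mem_of_add_mem_of_mem_right {I : Ideal R} {g h : R} (hgh : g + h ∈ I) (hh : h ∈ I) :
    g ∈ I :=
  (Ideal.add_mem_iff_left I hh).1 hgh

/-- If `q` is a nonzerodivisor modulo `(p, r)`, then `(p, q) ∩ (p, r) = (p, q r)`. -/
theorem mem_span_pair_mul {p q r h : R}
    (hr : ∀ t, q * t ∈ Ideal.span {p, r} → t ∈ Ideal.span {p, r})
    (h₁ : h ∈ Ideal.span {p, q}) (h₂ : h ∈ Ideal.span {p, r}) : h ∈ Ideal.span {p, q * r} := by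
  obtain ⟨s, t, rfl⟩ := Ideal.mem_span_pair.1 h₁
  have h3 : q * t ∈ Ideal.span {p, r} := by
    have : q * t = (s * p + t * q) - s * p := by ring
    rw [this]
    exact Ideal.sub_mem _ h₂ (Ideal.mul_mem_left _ _ (Ideal.subset_span (by simp)))
  obtain ⟨m, n, hmn⟩ := Ideal.mem_span_pair.1 (hr t h3)
  exact Ideal.mem_span_pair.2 ⟨s + m * q, n, by linear_combination q * hmn⟩

/-- The regular sequence `(p, q)` is quasi-regular in degree one: a linear form in `p, q` lies in
`(p, q) ^ 2` only if its coefficients lie in `(p, q)`. -/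
theorem mem_span_pair_of_add_mem_sq [IsDomain R] {p q e f : R} (hp : Prime p) (hpq : ¬ p ∣ q)
    (h : e * p + f * q ∈ Ideal.span {p, q} ^ 2) :
    e ∈ Ideal.span {p, q} ∧ f ∈ Ideal.span {p, q} := by
  rw [pow_two, Ideal.span_pair_mul_span_pair, Ideal.mem_span_insert] at h
  obtain ⟨r₁, t, ht, h⟩ := h
  rw [Ideal.mem_span_insert] at ht
  obtain ⟨r₂, t', ht', rfl⟩ := ht
  obtain ⟨r₃, r₄, rfl⟩ := Ideal.mem_span_pair.1 ht'
  have hdvd : p ∣ q * (r₄ * q - f) :=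
    ⟨e - r₁ * p - r₂ * q - r₃ * q, by linear_combination -h⟩
  obtain ⟨k, hk⟩ := (hp.dvd_or_dvd hdvd).resolve_left hpq
  have he : e = r₁ * p + (r₂ + r₃ + k) * q := by
    apply mul_right_cancel₀ hp.ne_zero
    linear_combination h + q * hk
  exact ⟨Ideal.mem_span_pair.2 ⟨_, _, he.symm⟩,
    Ideal.mem_span_pair.2 ⟨-k, r₄, by linear_combination hk⟩⟩

theorem two_le_height_of_mem [IsDomain R] {P : Ideal R} [P.IsPrime] {p q : R} (hp : Prime p)
    (hpq : ¬ p ∣ q) (hpP : p ∈ P) (hqP : q ∈ P) : 2 ≤ P.height := by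
  have : (Ideal.span {p}).IsPrime := (Ideal.span_singleton_prime hp.ne_zero).2 hp
  have h₁ := Ideal.height_add_one_le_of_lt_of_isPrime (I := ⊥) (J := Ideal.span {p})
    (bot_lt_iff_ne_bot.2 (by simpa using hp.ne_zero))
  have h₂ := Ideal.height_add_one_le_of_lt_of_isPrime (I := Ideal.span {p}) (J := P)
    (lt_of_le_of_ne ((Ideal.span_singleton_le_iff_mem _).2 hpP) fun h ↦
      hpq (Ideal.mem_span_singleton.1 (h ▸ hqP)))
  calc (2 : ℕ∞) = 0 + 1 + 1 := by norm_num
    _ ≤ (⊥ : Ideal R).height + 1 + 1 := by gcongr; exact zero_le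
    _ ≤ (Ideal.span {p}).height + 1 := by gcongr
    _ ≤ P.height := h₂

theorem height_span_pair_le [IsNoetherianRing R] {p q : R} [h : (Ideal.span {p, q}).IsPrime] :
    (Ideal.span {p, q}).height ≤ 2 := by
  refine (Ideal.height_le_spanFinrank _ h.ne_top).trans ?_
  have := Submodule.spanFinrank_span_le_ncard_of_finite (R := R) (s := {p, q}) (Set.toFinite _)
  exact_mod_cast this.trans ((Set.ncard_insert_le _ _).trans (by simp))

/-- A prime polynomial `q` that does not involve the variable `X i` generates, together with
`X i`, a prime ideal. Not involving `X i` is expressed by invariance under `X i ↦ 0`. -/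
theorem isPrime_span_X_pair {σ : Type*} [DecidableEq σ] {i : σ} {q : MvPolynomial σ R}
    (hq : Prime q) (h : aeval (Function.update X i (0 : MvPolynomial σ R)) q = q) :
    (Ideal.span {X i, q}).IsPrime := by
  set φ := aeval (R := R) (Function.update X i (0 : MvPolynomial σ R)) with hφ
  have hX : φ (X i) = 0 := by simp [hφ]
  have hmem : ∀ f, f ∈ Ideal.span {X i, q} ↔ q ∣ φ f := by
    intro f
    constructor
    · intro hf
      obtain ⟨s, t, rfl⟩ := Ideal.mem_span_pair.1 hf
      simp [hX, h]
    · rintro ⟨t, ht⟩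
      have hcomp : (Ideal.Quotient.mkₐ R (Ideal.span {X i})).comp φ = Ideal.Quotient.mkₐ R _ := by
        refine algHom_ext fun j ↦ ?_
        rcases eq_or_ne j i with rfl | hj
        · simp [hX]
        · simp [hφ, hj]
      have hsub : f - φ f ∈ Ideal.span {X i} :=
        Ideal.Quotient.eq.1 (DFunLike.congr_fun hcomp f).symm
      obtain ⟨s, hs⟩ := Ideal.mem_span_singleton'.1 hsub
      exact Ideal.mem_span_pair.2 ⟨s, t, by linear_combination hs - ht⟩
  refine ⟨fun htop ↦ hq.not_isUnit (isUnit_of_dvd_one ?_), fun {f g} hfg ↦ ?_⟩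
  · simpa using (hmem 1).1 (htop ▸ Submodule.mem_top)
  · simp only [hmem, map_mul] at hfg ⊢
    exact hq.dvd_or_dvd hfg

theorem not_X_dvd {σ : Type*} [DecidableEq σ] {i : σ} {q : MvPolynomial σ R}
    (hq : q ≠ 0) (h : aeval (Function.update X i (0 : MvPolynomial σ R)) q = q) : ¬ X i ∣ q := by
  rintro ⟨t, rfl⟩
  apply hq
  rw [← h]
  simp

end Pairs

/-! ### Symbolic powers -/

/-- Membership in a symbolic power, tested at one associated prime without localizing. -/
theorem exists_notMem_mul_mem_of_mem_symbolicPower {R : Type*} [CommRing R] {I P : Ideal R} {n : ℕ}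
    (hP : P ∈ associatedPrimes R (R ⧸ I)) {h : R} (hh : h ∈ symbolicPower I n) :
    ∃ s ∉ P, s * h ∈ I ^ n := by
  have := hP.isPrime
  have h' := (Ideal.mem_iInf.1 hh) ⟨P, hP⟩
  rw [Ideal.mem_comap, IsLocalization.algebraMap_mem_map_algebraMap_iff P.primeCompl] at h'
  exact h'

theorem mem_symbolicPower_of_forall {R : Type*} [CommRing R] {I : Ideal R} {n : ℕ} {h : R}
    (hh : ∀ P ∈ associatedPrimes R (R ⧸ I), ∃ s ∉ P, s * h ∈ I ^ n) : h ∈ symbolicPower I n := by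
  refine Ideal.mem_iInf.2 fun P ↦ ?_
  rw [Ideal.mem_comap, IsLocalization.algebraMap_mem_map_algebraMap_iff P.1.primeCompl]
  exact hh P.1 P.2

theorem pow_le_symbolicPower {R : Type*} [CommRing R] (I : Ideal R) (n : ℕ) :
    I ^ n ≤ symbolicPower I n := fun h hh ↦
  mem_symbolicPower_of_forall fun P hP ↦
    ⟨1, (Ideal.ne_top_iff_one P).1 hP.isPrime.ne_top, by simpa using hh⟩

/-! ### The minimal primes of the ideal -/

theorem prime_quadric : Prime 𝐰 := by
  have h : IsRelPrime 𝐛 (-(𝐜 * 𝐝)) := by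
    refine (X_prime.irreducible.isRelPrime_iff_not_dvd).2 fun h ↦ ?_
    rw [dvd_neg] at h
    rcases X_prime.dvd_or_dvd h with h | h <;> simp [X_dvd_X] at h
  -- As a polynomial in `a`, it is linear with coprime coefficients `b` and `-cd`.
  have := irreducible_mul_X_add 𝐛 (-(𝐜 * 𝐝)) 3 (X_ne_zero _) (by simp [vars_X])
    (by
      rw [vars_neg]
      intro h
      have := vars_mul _ _ h
      simp [vars_X] at this) h
  have e : 𝐰 = 𝐛 * 𝐚 + -(𝐜 * 𝐝) := by ring
  rw [e]
  exact this.prime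

/-- `IsComponentPair p q` lists the generators `p, q` of the twelve minimal primes of
`exampleIdeal`. -/
inductive IsComponentPair : MvPolynomial (Fin 7) ℚ → MvPolynomial (Fin 7) ℚ → Prop
  | xy : IsComponentPair 𝐱 𝐲
  | xz : IsComponentPair 𝐱 𝐳
  | yz : IsComponentPair 𝐲 𝐳
  | xw : IsComponentPair 𝐱 𝐰
  | yc : IsComponentPair 𝐲 𝐜
  | yd : IsComponentPair 𝐲 𝐝
  | za : IsComponentPair 𝐳 𝐚
  | zb : IsComponentPair 𝐳 𝐛
  | ac : IsComponentPair 𝐚 𝐜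
  | ad : IsComponentPair 𝐚 𝐝
  | bc : IsComponentPair 𝐛 𝐜
  | bd : IsComponentPair 𝐛 𝐝

namespace IsComponentPair

variable {p q : MvPolynomial (Fin 7) ℚ}

theorem spec (h : IsComponentPair p q) : (Ideal.span {p, q}).IsPrime ∧ Prime p ∧ ¬ p ∣ q := by
  have key : ∃ i, p = X i ∧ Prime q ∧
      aeval (R := ℚ) (Function.update X i (0 : MvPolynomial (Fin 7) ℚ)) q = q := by
    cases h
    all_goals exact ⟨_, rfl, by first | exact X_prime | exact prime_quadric, by simp⟩
  obtain ⟨i, rfl, hq, h0⟩ := key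
  exact ⟨isPrime_span_X_pair hq h0, X_prime, not_X_dvd hq.ne_zero h0⟩

theorem isPrime (h : IsComponentPair p q) : (Ideal.span {p, q}).IsPrime := h.spec.1

end IsComponentPair

/-- A factor `s` can be cancelled modulo the prime ideal `(p, q)` when it does not vanish at some
point `v` of the zero locus of `p` and `q`. -/
theorem mem_of_mul_mem_of_eval_ne_zero {σ K : Type*} [CommRing K] {p q s f : MvPolynomial σ K}
    (hP : (Ideal.span {p, q}).IsPrime) (v : σ → K) (hp : eval v p = 0) (hq : eval v q = 0)
    (hs : eval v s ≠ 0) (h : s * f ∈ Ideal.span {p, q}) : f ∈ Ideal.span {p, q} := by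
  refine (hP.mem_or_mem h).resolve_left fun hs' ↦ hs ?_
  obtain ⟨m, n, rfl⟩ := Ideal.mem_span_pair.1 hs'
  simp [hp, hq]

theorem exampleIdeal_eq : exampleIdeal =
    Ideal.span {𝐱 * 𝐲 * 𝐚 * 𝐛, 𝐱 * 𝐳 * 𝐜 * 𝐝, 𝐲 * 𝐳 * 𝐰} := rfl

theorem mem_exampleIdeal_iff {h : MvPolynomial (Fin 7) ℚ} : h ∈ exampleIdeal ↔
    ∃ α β γ, h = α * (𝐱 * 𝐲 * 𝐚 * 𝐛) + β * (𝐱 * 𝐳 * 𝐜 * 𝐝) + γ * (𝐲 * 𝐳 * 𝐰) := by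
  rw [exampleIdeal_eq, Ideal.mem_span_insert]
  simp only [Ideal.mem_span_pair]
  constructor
  · rintro ⟨α, _, ⟨β, γ, rfl⟩, rfl⟩
    exact ⟨α, β, γ, by ring⟩
  · rintro ⟨α, β, γ, rfl⟩
    exact ⟨α, _, ⟨β, γ, rfl⟩, by ring⟩

theorem exampleIdeal_le_span {p q : MvPolynomial (Fin 7) ℚ} (h : IsComponentPair p q) :
    exampleIdeal ≤ Ideal.span {p, q} := by
  intro g hg
  obtain ⟨α, β, γ, rfl⟩ := mem_exampleIdeal_iff.1 hg
  have hp : Ideal.Quotient.mk (Ideal.span {p, q}) p = 0 :=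
    Ideal.Quotient.eq_zero_iff_mem.2 (Ideal.subset_span (by simp))
  have hq : Ideal.Quotient.mk (Ideal.span {p, q}) q = 0 :=
    Ideal.Quotient.eq_zero_iff_mem.2 (Ideal.subset_span (by simp))
  rw [← Ideal.Quotient.eq_zero_iff_mem]
  cases h
  all_goals
    simp only [map_add, map_sub, map_mul] at hp hq ⊢
    simp only [hp, hq]
    ring

theorem exists_componentPair_mem {P : Ideal (MvPolynomial (Fin 7) ℚ)} [hP : P.IsPrime]
    (h : exampleIdeal ≤ P) : ∃ p q, IsComponentPair p q ∧ p ∈ P ∧ q ∈ P := by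
  have h₁ : 𝐱 * 𝐲 * 𝐚 * 𝐛 ∈ P := h (Ideal.subset_span (by simp))
  have h₂ : 𝐱 * 𝐳 * 𝐜 * 𝐝 ∈ P := h (Ideal.subset_span (by simp))
  have h₃ : 𝐲 * 𝐳 * 𝐰 ∈ P := h (Ideal.subset_span (by simp))
  simp only [hP.mul_mem_iff_mem_or_mem] at h₁ h₂ h₃
  by_contra! H
  have h_xy := H _ _ .xy
  have h_xz := H _ _ .xz
  have h_yz := H _ _ .yz
  have h_xw := H _ _ .xw
  have h_yc := H _ _ .yc
  have h_yd := H _ _ .yd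
  have h_za := H _ _ .za
  have h_zb := H _ _ .zb
  have h_ac := H _ _ .ac
  have h_ad := H _ _ .ad
  have h_bc := H _ _ .bc
  have h_bd := H _ _ .bd
  clear H
  grind only

theorem two_le_height_of_exampleIdeal_le {P : Ideal (MvPolynomial (Fin 7) ℚ)} [P.IsPrime]
    (h : exampleIdeal ≤ P) : 2 ≤ P.height := by
  obtain ⟨p, q, hpq, h₁, h₂⟩ := exists_componentPair_mem h
  obtain ⟨-, hp, hdvd⟩ := hpq.spec
  exact two_le_height_of_mem hp hdvd h₁ h₂

theorem two_le_height_exampleIdeal : 2 ≤ exampleIdeal.height := by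
  rw [Ideal.height_eq_inf_minimalPrimes]
  exact le_iInf₂ fun J hJ ↦ have := hJ.1.1; two_le_height_of_exampleIdeal_le hJ.1.2

theorem height_exampleIdeal : exampleIdeal.height = 2 := by
  refine le_antisymm ?_ two_le_height_exampleIdeal
  have h := IsComponentPair.xy
  have := h.isPrime
  exact (Ideal.height_mono (exampleIdeal_le_span h)).trans height_span_pair_le

theorem span_pair_mem_associatedPrimes
    {p q : MvPolynomial (Fin 7) ℚ} (h : IsComponentPair p q) :
    Ideal.span {p, q} ∈ associatedPrimes (MvPolynomial (Fin 7) ℚ)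
      (MvPolynomial (Fin 7) ℚ ⧸ exampleIdeal) := by
  have := h.isPrime
  apply Module.associatedPrimes.minimalPrimes_annihilator_subset_associatedPrimes
  rw [Ideal.annihilator_quotient]
  exact Ideal.mem_minimalPrimes_of_height_le (exampleIdeal_le_span h)
    (height_span_pair_le.trans two_le_height_exampleIdeal)

/-- The condition imposed on the linear part of an element of the symbolic square by each minimal
prime `(p, q)`: a multiple of the element by some `s ∉ (p, q)` lies in `(p, q) ^ 2`. -/
theorem mem_span_of_mem_symbolicPower {p q e f r : MvPolynomial (Fin 7) ℚ}
    (hpq : IsComponentPair p q) (hr : r ∈ Ideal.span {p, q} ^ 2)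
    (h : e * p + f * q + r ∈ symbolicPower exampleIdeal 2) :
    e ∈ Ideal.span {p, q} ∧ f ∈ Ideal.span {p, q} := by
  obtain ⟨s, hs, hsh⟩ := exists_notMem_mul_mem_of_mem_symbolicPower
    (span_pair_mem_associatedPrimes hpq) h
  obtain ⟨hP, hp, hdvd⟩ := hpq.spec
  have h₁ := Ideal.pow_right_mono (exampleIdeal_le_span hpq) 2 hsh
  have h₂ : (s * e) * p + (s * f) * q ∈ Ideal.span {p, q} ^ 2 := by
    have e : (s * e) * p + (s * f) * q = s * (e * p + f * q + r) - s * r := by ring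
    rw [e]
    exact Ideal.sub_mem _ h₁ (Ideal.mul_mem_left _ _ hr)
  obtain ⟨h₃, h₄⟩ := mem_span_pair_of_add_mem_sq hp hdvd h₂
  exact ⟨(hP.mem_or_mem h₃).resolve_left hs, (hP.mem_or_mem h₄).resolve_left hs⟩

/-! ### The ideal as an intersection of primes -/

/-- Membership in an ideal generated by two squarefree monomials is read off from supports. -/
theorem mem_span_prod_X_pair_iff {σ K : Type*} [CommRing K] {S T : Finset σ}
    {h : MvPolynomial σ K} :
    h ∈ Ideal.span {∏ i ∈ S, X i, ∏ i ∈ T, X i} ↔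
      ∀ m ∈ h.support, (∀ i ∈ S, m i ≠ 0) ∨ ∀ i ∈ T, m i ≠ 0 := by
  classical
  have hprod : ∀ S : Finset σ, (∏ i ∈ S, X i : MvPolynomial σ K) =
      monomial (∑ i ∈ S, Finsupp.single i 1) 1 := fun S ↦ by
    rw [monomial_sum_one]; rfl
  have hle : ∀ (S : Finset σ) (m : σ →₀ ℕ),
      ∑ i ∈ S, Finsupp.single i 1 ≤ m ↔ ∀ i ∈ S, m i ≠ 0 := fun S m ↦ by
    simp only [Finsupp.le_def, Finsupp.finsetSum_apply, Finsupp.single_apply,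
      Finset.sum_ite_eq', ← Nat.one_le_iff_ne_zero]
    refine forall_congr' fun i ↦ ?_
    split_ifs with hi <;> simp [hi]
  have := mem_ideal_span_monomial_image (x := h)
    (s := {∑ i ∈ S, Finsupp.single i 1, ∑ i ∈ T, Finsupp.single i 1})
  rw [Set.image_pair, ← hprod, ← hprod] at this
  simpa [hle] using this

theorem mem_span_X_pair_iff {σ K : Type*} [CommRing K] {i j : σ} {h : MvPolynomial σ K} :
    h ∈ Ideal.span {X i, X j} ↔ ∀ m ∈ h.support, m i ≠ 0 ∨ m j ≠ 0 := by
  simpa using mem_span_prod_X_pair_iff (S := {i}) (T := {j}) (h := h)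

/-- The inclusion `⋂ (X i, X j) ⊆ (∏ X i, ∏ X j)`, the intersection over `i ∈ S` and `j ∈ T`. -/
theorem mem_span_prod_X_pair_of_forall {σ K : Type*} [CommRing K] {S T : Finset σ}
    {h : MvPolynomial σ K} (hmem : ∀ i ∈ S, ∀ j ∈ T, h ∈ Ideal.span {X i, X j}) :
    h ∈ Ideal.span {∏ i ∈ S, X i, ∏ i ∈ T, X i} := by
  simp only [mem_span_X_pair_iff] at hmem
  refine mem_span_prod_X_pair_iff.2 fun m hm ↦ ?_
  by_contra! H
  obtain ⟨⟨i, hi, hi0⟩, j, hj, hj0⟩ := H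
  exact (hmem i hi j hj m hm).elim (· hi0) (· hj0)

theorem mem_span_x_of_mem {h : MvPolynomial (Fin 7) ℚ} (h₁ : h ∈ Ideal.span {𝐱, 𝐲})
    (h₂ : h ∈ Ideal.span {𝐱, 𝐳}) (h₃ : h ∈ Ideal.span {𝐱, 𝐰}) :
    h ∈ Ideal.span {𝐱, 𝐲 * 𝐳 * 𝐰} := by
  refine mem_span_pair_mul (fun t ht ↦ ?_) (mem_span_pair_mul (fun t ht ↦ ?_) h₁ h₂) h₃
  · exact mem_of_mul_mem_of_eval_ne_zero
      IsComponentPair.xw.isPrime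
      ![0, 1, 1, 1, 1, 1, 1] (by simp) (by simp) (by simp) ht
  · exact mem_of_mul_mem_of_eval_ne_zero
      IsComponentPair.xz.isPrime
      ![0, 1, 0, 1, 1, 1, 1] (by simp) (by simp) (by simp) ht

theorem isComponentPair_X_or {i j : Fin 7} (hi : i ∈ ({1, 3, 4} : Finset (Fin 7)))
    (hj : j ∈ ({2, 5, 6} : Finset (Fin 7))) :
    IsComponentPair (X i) (X j) ∨ IsComponentPair (X j) (X i) := by
  simp only [Finset.mem_insert, Finset.mem_singleton] at hi hj
  rcases hi with rfl | rfl | rfl <;> rcases hj with rfl | rfl | rfl <;>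
    first | exact Or.inl (by constructor) | exact Or.inr (by constructor)

/-- The ideal contains the intersection of the twelve primes. The primes `(x, y)`, `(x, z)` and
`(x, w)` intersect in `(x, yzw)`; modulo the ideal, an element of this intersection is `x s`, and the
nine primes without `x` among their generators put `s` into `(yab, zcd)`. -/
theorem mem_exampleIdeal_of_forall {h : MvPolynomial (Fin 7) ℚ}
    (hh : ∀ p q, IsComponentPair p q → h ∈ Ideal.span {p, q}) : h ∈ exampleIdeal := by
  have hx := mem_span_x_of_mem (hh _ _ .xy) (hh _ _ .xz) (hh _ _ .xw)
  obtain ⟨s, t, rfl⟩ := Ideal.mem_span_pair.1 hx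
  have h₃ : t * (𝐲 * 𝐳 * 𝐰) ∈ exampleIdeal := mem_exampleIdeal_iff.2 ⟨0, 0, t, by ring⟩
  refine Ideal.add_mem _ ?_ h₃
  have hs : s ∈ Ideal.span {𝐲 * 𝐚 * 𝐛, 𝐳 * 𝐜 * 𝐝} := by
    have key := mem_span_prod_X_pair_of_forall (h := s) (S := ({1, 3, 4} : Finset (Fin 7)))
      (T := {2, 5, 6}) fun i hi j hj ↦ ?_
    · simpa [mul_assoc] using key
    have hi0 : i ≠ 0 := by rintro rfl; simp at hi
    have hj0 : j ≠ 0 := by rintro rfl; simp at hj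
    have key : ∀ p q, IsComponentPair p q → eval (Pi.single 0 1) p = 0 →
        eval (Pi.single 0 1) q = 0 → s ∈ Ideal.span {p, q} := fun p q hpq h₁ h₂ ↦ by
      refine mem_of_mul_mem_of_eval_ne_zero (s := 𝐱) hpq.isPrime (Pi.single 0 1) h₁ h₂ (by simp) ?_
      rw [mul_comm]
      exact mem_of_add_mem_of_mem_right (hh p q hpq) (exampleIdeal_le_span hpq h₃)
    rcases isComponentPair_X_or hi hj with hij | hij
    · exact key _ _ hij (by simp [hi0]) (by simp [hj0])
    · rw [Ideal.span_pair_comm]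
      exact key _ _ hij (by simp [hj0]) (by simp [hi0])
  obtain ⟨α, β, rfl⟩ := Ideal.mem_span_pair.1 hs
  exact mem_exampleIdeal_iff.2 ⟨α, β, 0, by ring⟩

theorem isRadical_exampleIdeal : exampleIdeal.IsRadical := by
  rintro h ⟨n, hn⟩
  exact mem_exampleIdeal_of_forall fun p q hpq ↦
    hpq.isPrime.mem_of_pow_mem n (exampleIdeal_le_span hpq hn)

/-! ### The symbolic square -/

/-- The condition of `mem_span_of_mem_symbolicPower` on the coefficient of `p`, with a factor `s`
cancelled. The factor is a unit at `(p, q)`, as witnessed by the point `v`. -/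
theorem left_mem_of_mem_symbolicPower {p q h s e f r : MvPolynomial (Fin 7) ℚ}
    (hh : h ∈ symbolicPower exampleIdeal 2) (v : Fin 7 → ℚ) (hpq : IsComponentPair p q)
    (hp : eval v p = 0) (hq : eval v q = 0) (hs : eval v s ≠ 0)
    (heq : h = s * e * p + f * q + r * (p * q)) : e ∈ Ideal.span {p, q} := by
  refine mem_of_mul_mem_of_eval_ne_zero hpq.isPrime v hp hq hs
    (mem_span_of_mem_symbolicPower hpq ?_ (heq ▸ hh)).1
  rw [pow_two]
  exact Ideal.mul_mem_left _ _ (Ideal.mul_mem_mul (Ideal.subset_span (by simp))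
    (Ideal.subset_span (by simp)))

/-- The condition of `mem_span_of_mem_symbolicPower` on the coefficient of `q`; see
`left_mem_of_mem_symbolicPower`. -/
theorem right_mem_of_mem_symbolicPower {p q h s e f r : MvPolynomial (Fin 7) ℚ}
    (hh : h ∈ symbolicPower exampleIdeal 2) (v : Fin 7 → ℚ) (hpq : IsComponentPair p q)
    (hp : eval v p = 0) (hq : eval v q = 0) (hs : eval v s ≠ 0)
    (heq : h = f * p + s * e * q + r * (p * q)) : e ∈ Ideal.span {p, q} := by
  refine mem_of_mul_mem_of_eval_ne_zero hpq.isPrime v hp hq hs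
    (mem_span_of_mem_symbolicPower hpq ?_ (heq ▸ hh)).2
  rw [pow_two]
  exact Ideal.mul_mem_left _ _ (Ideal.mul_mem_mul (Ideal.subset_span (by simp))
    (Ideal.subset_span (by simp)))

theorem exampleForm_eq : exampleForm = 𝐱 * 𝐲 * 𝐳 * 𝐚 * 𝐛 * 𝐜 * 𝐝 * 𝐰 := rfl

theorem mul_mem_sq_exampleIdeal {α β γ α' β' γ' h : MvPolynomial (Fin 7) ℚ}
    (heq : h = (α * (𝐱 * 𝐲 * 𝐚 * 𝐛) + β * (𝐱 * 𝐳 * 𝐜 * 𝐝) + γ * (𝐲 * 𝐳 * 𝐰)) *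
      (α' * (𝐱 * 𝐲 * 𝐚 * 𝐛) + β' * (𝐱 * 𝐳 * 𝐜 * 𝐝) + γ' * (𝐲 * 𝐳 * 𝐰))) :
    h ∈ exampleIdeal ^ 2 := by
  rw [heq, pow_two]
  exact Ideal.mul_mem_mul (mem_exampleIdeal_iff.2 ⟨_, _, _, rfl⟩)
    (mem_exampleIdeal_iff.2 ⟨_, _, _, rfl⟩)

section SymbolicSquare

variable {h α β γ : MvPolynomial (Fin 7) ℚ}

/-- The primes `(x, z)`, `(y, z)`, `(z, a)`, `(z, b)`, at which `xyab` has order one, bring the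
coefficient `α` into their intersection `(z, xyab)`. -/
theorem exists_eq_mul_left_add (hJ : h ∈ symbolicPower exampleIdeal 2)
    (heq : h = α * (𝐱 * 𝐲 * 𝐚 * 𝐛) + β * (𝐱 * 𝐳 * 𝐜 * 𝐝) + γ * (𝐲 * 𝐳 * 𝐰)) :
    ∃ α₁ α₂, α = α₁ * 𝐳 + α₂ * (𝐱 * 𝐲 * 𝐚 * 𝐛) := by
  have h₁ : α ∈ Ideal.span {𝐱, 𝐳} := left_mem_of_mem_symbolicPower hJ ![0, 1, 0, 1, 1, 1, 1] .xz
    (s := 𝐲 * 𝐚 * 𝐛) (f := γ * 𝐲 * 𝐰) (r := β * 𝐜 * 𝐝)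
    (by simp) (by simp) (by simp) (by rw [heq]; ring)
  have h₂ : α ∈ Ideal.span {𝐲, 𝐳} := left_mem_of_mem_symbolicPower hJ ![1, 0, 0, 1, 1, 1, 1] .yz
    (s := 𝐱 * 𝐚 * 𝐛) (f := β * 𝐱 * 𝐜 * 𝐝) (r := γ * 𝐰)
    (by simp) (by simp) (by simp) (by rw [heq]; ring)
  have h₃ : α ∈ Ideal.span {𝐳, 𝐚} := right_mem_of_mem_symbolicPower hJ ![1, 1, 0, 0, 1, 1, 1] .za
    (s := 𝐱 * 𝐲 * 𝐛) (f := β * 𝐱 * 𝐜 * 𝐝 + γ * 𝐲 * 𝐰) (r := 0)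
    (by simp) (by simp) (by simp) (by rw [heq]; ring)
  have h₄ : α ∈ Ideal.span {𝐳, 𝐛} := right_mem_of_mem_symbolicPower hJ ![1, 1, 0, 1, 0, 1, 1] .zb
    (s := 𝐱 * 𝐲 * 𝐚) (f := β * 𝐱 * 𝐜 * 𝐝 + γ * 𝐲 * 𝐰) (r := 0)
    (by simp) (by simp) (by simp) (by rw [heq]; ring)
  rw [Ideal.span_pair_comm] at h₁ h₂
  have key := mem_span_prod_X_pair_of_forall (h := α) (S := ({2} : Finset (Fin 7)))
    (T := {0, 1, 3, 4}) (by simp [h₁, h₂, h₃, h₄])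
  obtain ⟨α₁, α₂, h₅⟩ := Ideal.mem_span_pair.1 key
  exact ⟨α₁, α₂, by rw [← h₅]; simp [mul_assoc]⟩

/-- The analogue of `exists_eq_mul_left_add` for `xzcd` and the primes `(x, y)`, `(y, z)`, `(y, c)`,
`(y, d)`. -/
theorem exists_eq_mul_middle_add (hJ : h ∈ symbolicPower exampleIdeal 2)
    (heq : h = α * (𝐱 * 𝐲 * 𝐚 * 𝐛) + β * (𝐱 * 𝐳 * 𝐜 * 𝐝) + γ * (𝐲 * 𝐳 * 𝐰)) :
    ∃ β₁ β₂, β = β₁ * 𝐲 + β₂ * (𝐱 * 𝐳 * 𝐜 * 𝐝) := by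
  have h₁ : β ∈ Ideal.span {𝐱, 𝐲} := left_mem_of_mem_symbolicPower hJ ![0, 0, 1, 1, 1, 1, 1] .xy
    (s := 𝐳 * 𝐜 * 𝐝) (f := γ * 𝐳 * 𝐰) (r := α * 𝐚 * 𝐛)
    (by simp) (by simp) (by simp) (by rw [heq]; ring)
  have h₂ : β ∈ Ideal.span {𝐲, 𝐳} := right_mem_of_mem_symbolicPower hJ ![1, 0, 0, 1, 1, 1, 1] .yz
    (s := 𝐱 * 𝐜 * 𝐝) (f := α * 𝐱 * 𝐚 * 𝐛) (r := γ * 𝐰)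
    (by simp) (by simp) (by simp) (by rw [heq]; ring)
  have h₃ : β ∈ Ideal.span {𝐲, 𝐜} := right_mem_of_mem_symbolicPower hJ ![1, 0, 1, 1, 1, 0, 1] .yc
    (s := 𝐱 * 𝐳 * 𝐝) (f := α * 𝐱 * 𝐚 * 𝐛 + γ * 𝐳 * 𝐰) (r := 0)
    (by simp) (by simp) (by simp) (by rw [heq]; ring)
  have h₄ : β ∈ Ideal.span {𝐲, 𝐝} := right_mem_of_mem_symbolicPower hJ ![1, 0, 1, 1, 1, 1, 0] .yd
    (s := 𝐱 * 𝐳 * 𝐜) (f := α * 𝐱 * 𝐚 * 𝐛 + γ * 𝐳 * 𝐰) (r := 0)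
    (by simp) (by simp) (by simp) (by rw [heq]; ring)
  rw [Ideal.span_pair_comm] at h₁
  have key := mem_span_prod_X_pair_of_forall (h := β) (S := ({1} : Finset (Fin 7)))
    (T := {0, 2, 5, 6}) (by simp [h₁, h₂, h₃, h₄])
  obtain ⟨β₁, β₂, h₅⟩ := Ideal.mem_span_pair.1 key
  exact ⟨β₁, β₂, by rw [← h₅]; simp [mul_assoc]⟩

/-- The analogue of `exists_eq_mul_left_add` for `yz(ab - cd)` and the primes `(x, y)`, `(x, z)`,
`(x, ab - cd)`. -/
theorem exists_eq_mul_right_add (hJ : h ∈ symbolicPower exampleIdeal 2)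
    (heq : h = α * (𝐱 * 𝐲 * 𝐚 * 𝐛) + β * (𝐱 * 𝐳 * 𝐜 * 𝐝) + γ * (𝐲 * 𝐳 * 𝐰)) :
    ∃ γ₁ γ₂, γ = γ₁ * 𝐱 + γ₂ * (𝐲 * 𝐳 * 𝐰) := by
  have h₁ : γ ∈ Ideal.span {𝐱, 𝐲} := right_mem_of_mem_symbolicPower hJ ![0, 0, 1, 2, 1, 1, 1] .xy
    (s := 𝐳 * 𝐰) (f := β * 𝐳 * 𝐜 * 𝐝) (r := α * 𝐚 * 𝐛)
    (by simp) (by simp) (by simp; norm_num) (by rw [heq]; ring)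
  have h₂ : γ ∈ Ideal.span {𝐱, 𝐳} := right_mem_of_mem_symbolicPower hJ ![0, 1, 0, 2, 1, 1, 1] .xz
    (s := 𝐲 * 𝐰) (f := α * 𝐲 * 𝐚 * 𝐛) (r := β * 𝐜 * 𝐝)
    (by simp) (by simp) (by simp; norm_num) (by rw [heq]; ring)
  have h₃ : γ ∈ Ideal.span {𝐱, 𝐰} := right_mem_of_mem_symbolicPower hJ ![0, 1, 1, 1, 1, 1, 1] .xw
    (s := 𝐲 * 𝐳) (f := α * 𝐲 * 𝐚 * 𝐛 + β * 𝐳 * 𝐜 * 𝐝) (r := 0)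
    (by simp) (by simp) (by simp) (by rw [heq]; ring)
  obtain ⟨γ₁, γ₂, h₄⟩ := Ideal.mem_span_pair.1 (mem_span_x_of_mem h₁ h₂ h₃)
  exact ⟨γ₁, γ₂, h₄.symm⟩

/-- Modulo `exampleIdeal ^ 2`, every element of the symbolic square is a multiple of `xyz`, with
cofactor in `(ab, cd)`. -/
theorem exists_eq_xyz_mul_add (hJ : h ∈ symbolicPower exampleIdeal 2) :
    ∃ α β, ∃ r ∈ exampleIdeal ^ 2,
      h = 𝐱 * 𝐲 * 𝐳 * (α * (𝐚 * 𝐛) + β * (𝐜 * 𝐝)) + r := by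
  have hI : h ∈ exampleIdeal := mem_exampleIdeal_of_forall fun p q hpq ↦ by
    obtain ⟨s, hs, hsh⟩ := exists_notMem_mul_mem_of_mem_symbolicPower
      (span_pair_mem_associatedPrimes hpq) hJ
    exact (hpq.isPrime.mem_or_mem (exampleIdeal_le_span hpq
      (Ideal.pow_le_self two_ne_zero hsh))).resolve_left hs
  obtain ⟨α, β, γ, heq⟩ := mem_exampleIdeal_iff.1 hI
  obtain ⟨α₁, α₂, hα⟩ := exists_eq_mul_left_add hJ heq
  obtain ⟨β₁, β₂, hβ⟩ := exists_eq_mul_middle_add hJ heq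
  obtain ⟨γ₁, γ₂, hγ⟩ := exists_eq_mul_right_add hJ heq
  -- The summand `γ₁ xyz(ab - cd)` is split between the coefficients of `ab` and `cd`.
  refine ⟨α₁ + γ₁, β₁ - γ₁, _, Ideal.add_mem _ (Ideal.add_mem _
    (mul_mem_sq_exampleIdeal (α := α₂) (β := 0) (γ := 0) (α' := 1) (β' := 0) (γ' := 0) rfl)
    (mul_mem_sq_exampleIdeal (α := 0) (β := β₂) (γ := 0) (α' := 0) (β' := 1) (γ' := 0) rfl))
    (mul_mem_sq_exampleIdeal (α := 0) (β := 0) (γ := γ₂) (α' := 0) (β' := 0) (γ' := 1) rfl), ?_⟩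
  rw [heq, hα, hβ, hγ]
  ring

/-- Modulo `exampleIdeal ^ 2`, an element `xyz(α ab + β cd)` of the symbolic square is a multiple
of `xyzabcd`. -/
theorem exists_eq_xyzabcd_mul_add
    (hJ : 𝐱 * 𝐲 * 𝐳 * (α * (𝐚 * 𝐛) + β * (𝐜 * 𝐝)) ∈ symbolicPower exampleIdeal 2) :
    ∃ δ, ∃ r ∈ exampleIdeal ^ 2, 𝐱 * 𝐲 * 𝐳 * (α * (𝐚 * 𝐛) + β * (𝐜 * 𝐝)) =
      𝐱 * 𝐲 * 𝐳 * 𝐚 * 𝐛 * 𝐜 * 𝐝 * δ + r := by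
  have h₁ : α ∈ Ideal.span {𝐲, 𝐜} := left_mem_of_mem_symbolicPower hJ ![1, 0, 1, 1, 1, 0, 1] .yc
    (s := 𝐱 * 𝐳 * 𝐚 * 𝐛) (f := 0) (r := β * 𝐱 * 𝐳 * 𝐝) (by simp) (by simp) (by simp) (by ring)
  have h₂ : α ∈ Ideal.span {𝐲, 𝐝} := left_mem_of_mem_symbolicPower hJ ![1, 0, 1, 1, 1, 1, 0] .yd
    (s := 𝐱 * 𝐳 * 𝐚 * 𝐛) (f := 0) (r := β * 𝐱 * 𝐳 * 𝐜) (by simp) (by simp) (by simp) (by ring)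
  have h₃ : β ∈ Ideal.span {𝐳, 𝐚} := left_mem_of_mem_symbolicPower hJ ![1, 1, 0, 0, 1, 1, 1] .za
    (s := 𝐱 * 𝐲 * 𝐜 * 𝐝) (f := 0) (r := α * 𝐱 * 𝐲 * 𝐛) (by simp) (by simp) (by simp) (by ring)
  have h₄ : β ∈ Ideal.span {𝐳, 𝐛} := left_mem_of_mem_symbolicPower hJ ![1, 1, 0, 1, 0, 1, 1] .zb
    (s := 𝐱 * 𝐲 * 𝐜 * 𝐝) (f := 0) (r := α * 𝐱 * 𝐲 * 𝐚) (by simp) (by simp) (by simp) (by ring)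
  have h₅ : α ∈ Ideal.span {𝐚, 𝐜} := left_mem_of_mem_symbolicPower hJ ![1, 1, 1, 0, 1, 0, 1] .ac
    (s := 𝐱 * 𝐲 * 𝐳 * 𝐛) (f := β * (𝐱 * 𝐲 * 𝐳 * 𝐝)) (r := 0)
    (by simp) (by simp) (by simp) (by ring)
  have h₆ : β ∈ Ideal.span {𝐚, 𝐜} := right_mem_of_mem_symbolicPower hJ ![1, 1, 1, 0, 1, 0, 1] .ac
    (s := 𝐱 * 𝐲 * 𝐳 * 𝐝) (f := α * (𝐱 * 𝐲 * 𝐳 * 𝐛)) (r := 0)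
    (by simp) (by simp) (by simp) (by ring)
  have h₇ : α ∈ Ideal.span {𝐚, 𝐝} := left_mem_of_mem_symbolicPower hJ ![1, 1, 1, 0, 1, 1, 0] .ad
    (s := 𝐱 * 𝐲 * 𝐳 * 𝐛) (f := β * (𝐱 * 𝐲 * 𝐳 * 𝐜)) (r := 0)
    (by simp) (by simp) (by simp) (by ring)
  have h₈ : β ∈ Ideal.span {𝐚, 𝐝} := right_mem_of_mem_symbolicPower hJ ![1, 1, 1, 0, 1, 1, 0] .ad
    (s := 𝐱 * 𝐲 * 𝐳 * 𝐜) (f := α * (𝐱 * 𝐲 * 𝐳 * 𝐛)) (r := 0)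
    (by simp) (by simp) (by simp) (by ring)
  have h₉ : α ∈ Ideal.span {𝐛, 𝐜} := left_mem_of_mem_symbolicPower hJ ![1, 1, 1, 1, 0, 0, 1] .bc
    (s := 𝐱 * 𝐲 * 𝐳 * 𝐚) (f := β * (𝐱 * 𝐲 * 𝐳 * 𝐝)) (r := 0)
    (by simp) (by simp) (by simp) (by ring)
  have h₁₀ : β ∈ Ideal.span {𝐛, 𝐜} := right_mem_of_mem_symbolicPower hJ ![1, 1, 1, 1, 0, 0, 1] .bc
    (s := 𝐱 * 𝐲 * 𝐳 * 𝐝) (f := α * (𝐱 * 𝐲 * 𝐳 * 𝐚)) (r := 0)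
    (by simp) (by simp) (by simp) (by ring)
  have h₁₁ : α ∈ Ideal.span {𝐛, 𝐝} := left_mem_of_mem_symbolicPower hJ ![1, 1, 1, 1, 0, 1, 0] .bd
    (s := 𝐱 * 𝐲 * 𝐳 * 𝐚) (f := β * (𝐱 * 𝐲 * 𝐳 * 𝐜)) (r := 0)
    (by simp) (by simp) (by simp) (by ring)
  have h₁₂ : β ∈ Ideal.span {𝐛, 𝐝} := right_mem_of_mem_symbolicPower hJ ![1, 1, 1, 1, 0, 1, 0] .bd
    (s := 𝐱 * 𝐲 * 𝐳 * 𝐜) (f := α * (𝐱 * 𝐲 * 𝐳 * 𝐚)) (r := 0)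
    (by simp) (by simp) (by simp) (by ring)
  rw [Ideal.span_pair_comm] at h₆ h₈ h₁₀ h₁₂
  have hα := mem_span_prod_X_pair_of_forall (h := α) (S := ({1, 3, 4} : Finset (Fin 7)))
    (T := {5, 6}) (by simp [h₁, h₂, h₅, h₇, h₉, h₁₁])
  have hβ := mem_span_prod_X_pair_of_forall (h := β) (S := ({2, 5, 6} : Finset (Fin 7)))
    (T := {3, 4}) (by simp [h₃, h₄, h₆, h₈, h₁₀, h₁₂])
  obtain ⟨α₁, α₂, hα⟩ := Ideal.mem_span_pair.1 hα
  obtain ⟨β₁, β₂, hβ⟩ := Ideal.mem_span_pair.1 hβ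
  have hα : α = α₁ * (𝐲 * 𝐚 * 𝐛) + α₂ * (𝐜 * 𝐝) := by rw [← hα]; simp [mul_assoc]
  have hβ : β = β₁ * (𝐳 * 𝐜 * 𝐝) + β₂ * (𝐚 * 𝐛) := by rw [← hβ]; simp [mul_assoc]
  -- Modulo the square, `ab` and `cd` may be exchanged in `xy²zab · ab` and in `xyz²cd · cd`,
  -- since up to sign the differences are `xyab · yz(ab - cd)` and `xzcd · yz(ab - cd)`.
  refine ⟨α₂ + β₂ + α₁ * 𝐲 + β₁ * 𝐳, _,
    mul_mem_sq_exampleIdeal (α := α₁) (β := -β₁) (γ := 0) (α' := 0) (β' := 0) (γ' := 1) rfl, ?_⟩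
  rw [hα, hβ]
  ring

theorem symbolicPower_exampleIdeal_two_le : symbolicPower exampleIdeal 2 ≤
    exampleIdeal ^ 2 ⊔ Ideal.span {exampleForm} := by
  intro h hJ
  obtain ⟨α, β, r, hr, rfl⟩ := exists_eq_xyz_mul_add hJ
  have hJ := mem_of_add_mem_of_mem_right hJ (pow_le_symbolicPower _ _ hr)
  obtain ⟨δ, s, hs, heq⟩ := exists_eq_xyzabcd_mul_add hJ
  rw [heq] at hJ ⊢
  have hJ := mem_of_add_mem_of_mem_right hJ (pow_le_symbolicPower _ _ hs)
  have hδ : δ ∈ Ideal.span {𝐱, 𝐰} := left_mem_of_mem_symbolicPower hJ ![0, 1, 1, 1, 1, 1, 1] .xw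
    (s := 𝐲 * 𝐳 * 𝐚 * 𝐛 * 𝐜 * 𝐝) (f := 0) (r := 0) (by simp) (by simp) (by simp) (by ring)
  obtain ⟨δ₁, δ₂, rfl⟩ := Ideal.mem_span_pair.1 hδ
  refine Ideal.add_mem _ (Ideal.add_mem _ ?_ (Ideal.mem_sup_left hs)) (Ideal.mem_sup_left hr)
  refine Submodule.mem_sup.2 ⟨_,
    mul_mem_sq_exampleIdeal (α := δ₁) (β := 0) (γ := 0) (α' := 0) (β' := 1) (γ' := 0) rfl,
    δ₂ * exampleForm, Ideal.mul_mem_left _ _ (Ideal.mem_span_singleton_self _), ?_⟩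
  rw [exampleForm_eq]
  ring

/-- An element multiplied into `exampleIdeal` by `x`, `y` and `z` lies in `exampleIdeal`, because no
minimal prime of `exampleIdeal` contains all three variables. -/
theorem mem_exampleIdeal_of_mul_mem (hx : 𝐱 * h ∈ exampleIdeal) (hy : 𝐲 * h ∈ exampleIdeal)
    (hz : 𝐳 * h ∈ exampleIdeal) : h ∈ exampleIdeal := by
  refine mem_exampleIdeal_of_forall fun p q hpq ↦ ?_
  have hP := hpq.isPrime
  have hle := exampleIdeal_le_span hpq
  have hx := hle hx
  have hy := hle hy
  have hz := hle hz
  cases hpq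
  case xy =>
    exact mem_of_mul_mem_of_eval_ne_zero hP ![0, 0, 1, 0, 0, 0, 0] (by simp) (by simp) (by simp) hz
  case xz =>
    exact mem_of_mul_mem_of_eval_ne_zero hP ![0, 1, 0, 0, 0, 0, 0] (by simp) (by simp) (by simp) hy
  case xw =>
    exact mem_of_mul_mem_of_eval_ne_zero hP ![0, 1, 0, 0, 0, 0, 0] (by simp) (by simp) (by simp) hy
  all_goals
    exact mem_of_mul_mem_of_eval_ne_zero hP ![1, 0, 0, 0, 0, 0, 0] (by simp) (by simp) (by simp) hx

/-- The multiples `xf`, `yf`, `zf` of the form lie in the square of the ideal, and no associated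
prime contains all of `x`, `y`, `z`. -/
theorem exampleForm_mem_symbolicPower : exampleForm ∈ symbolicPower exampleIdeal 2 := by
  refine mem_symbolicPower_of_forall fun P hP ↦ ?_
  obtain ⟨hprime, m, hm⟩ := isAssociatedPrime_iff.1 hP
  obtain ⟨g, rfl⟩ := Ideal.Quotient.mk_surjective m
  have hmem : ∀ s, s ∈ P ↔ s * g ∈ exampleIdeal := fun s ↦ by
    rw [hm, Submodule.mem_colon_singleton, Submodule.mem_bot, ← Ideal.Quotient.eq_zero_iff_mem,
      map_mul]
    rfl
  by_contra! H
  have hx : 𝐱 ∈ P := by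
    by_contra hx
    refine H _ hx (mul_mem_sq_exampleIdeal (α := 𝐰) (β := 0) (γ := 0)
      (α' := 0) (β' := 1) (γ' := 0) ?_)
    rw [exampleForm_eq]; ring
  have hy : 𝐲 ∈ P := by
    by_contra hy
    refine H _ hy (mul_mem_sq_exampleIdeal (α := 𝐜 * 𝐝) (β := 0) (γ := 0)
      (α' := 0) (β' := 0) (γ' := 1) ?_)
    rw [exampleForm_eq]; ring
  have hz : 𝐳 ∈ P := by
    by_contra hz
    refine H _ hz (mul_mem_sq_exampleIdeal (α := 0) (β := 𝐚 * 𝐛) (γ := 0)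
      (α' := 0) (β' := 0) (γ' := 1) ?_)
    rw [exampleForm_eq]; ring
  rw [hmem] at hx hy hz
  refine hprime.ne_top ((Ideal.eq_top_iff_one P).2 ((hmem 1).2 ?_))
  rw [one_mul]
  exact mem_exampleIdeal_of_mul_mem hx hy hz

theorem symbolicPower_exampleIdeal_two :
    symbolicPower exampleIdeal 2 = exampleIdeal ^ 2 ⊔ Ideal.span {exampleForm} :=
  le_antisymm symbolicPower_exampleIdeal_two_le
    (sup_le (pow_le_symbolicPower _ _)
      ((Ideal.span_singleton_le_iff_mem _).2 exampleForm_mem_symbolicPower))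

end SymbolicSquare

/-! ### A flatness criterion for Cohen-Macaulay rings -/

open RingTheory.Sequence in
theorem RingEquiv.isWeaklyRegular_iff {R S : Type*} [CommRing R] [CommRing S] (e : R ≃+* S)
    (rs : List R) : IsWeaklyRegular R rs ↔ IsWeaklyRegular S (rs.map e) :=
  e.toAddEquiv.isWeaklyRegular_congr <| List.forall₂_map_right_iff.mpr <|
    List.forall₂_same.mpr fun r _ x ↦ map_mul e r x

open RingTheory.Sequence Pointwise in
/-- Adjoining a monic polynomial in a new variable at the front of a weakly regular sequence. -/
theorem isWeaklyRegular_monic_cons_map_C {S : Type*} [CommRing S] {q : Polynomial S} (hq : q.Monic)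
    {rs : List S} (hrs : IsWeaklyRegular S rs) :
    IsWeaklyRegular (Polynomial S) (q :: rs.map Polynomial.C) := by
  have := hq.free_quotient
  refine .cons (fun f g hfg ↦ hq.isRegular.left hfg) ?_
  have h₁ : (q • ⊤ : Submodule (Polynomial S) (Polynomial S)) = Ideal.span {q} := by
    simp [← Submodule.ideal_span_singleton_smul]
  have h₂ := (isWeaklyRegular_map_algebraMap_iff (Polynomial S ⧸ Ideal.span {q}) _ rs).1
    (hrs.of_flat (S := Polynomial S ⧸ Ideal.span {q}))
  exact ((Submodule.quotEquivOfEq _ _ h₁).isWeaklyRegular_congr _).2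
    ((isWeaklyRegular_map_algebraMap_iff (Polynomial S) _ rs).2 h₂)

open RingTheory.Sequence in
/-- Monic polynomials in separate variables form a weakly regular sequence. -/
theorem isWeaklyRegular_ofFn_aeval_X {R : Type*} [CommRing R] :
    ∀ {n : ℕ} (p : Fin n → Polynomial R), (∀ i, (p i).Monic) →
      IsWeaklyRegular (MvPolynomial (Fin n) R)
        (List.ofFn fun i ↦ Polynomial.aeval (X i : MvPolynomial (Fin n) R) (p i))
  | 0, _, _ => by simp
  | n + 1, p, hp => by
    rw [(finSuccEquiv R n).toRingEquiv.isWeaklyRegular_iff, List.map_ofFn, List.ofFn_succ]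
    have h := isWeaklyRegular_monic_cons_map_C ((hp 0).map (algebraMap R (MvPolynomial (Fin n) R)))
      (isWeaklyRegular_ofFn_aeval_X (fun i : Fin n ↦ p i.succ) fun i ↦ hp i.succ)
    rw [List.map_ofFn] at h
    convert h using 2
    · change finSuccEquiv R n (Polynomial.aeval (X 0) (p 0)) = _
      rw [← Polynomial.aeval_algHom_apply, finSuccEquiv_X_zero,
        ← Polynomial.aeval_map_algebraMap (MvPolynomial (Fin n) R), Polynomial.aeval_X_left_apply]
    · congr 1
      funext i
      change finSuccEquiv R n (Polynomial.aeval (X i.succ) (p i.succ)) = Polynomial.C _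
      rw [← Polynomial.aeval_algHom_apply, finSuccEquiv_X_succ]
      exact Polynomial.aeval_algebraMap_apply _ _ _

/-- An algebra of dimension at most `n` that is flat over a polynomial ring in `n` variables is
Cohen-Macaulay. By the Nullstellensatz, each maximal ideal contains monic polynomials in the images
of the variables, one in each; they form a regular sequence of length `n`. -/
theorem isCohenMacaulayRing_of_flat {K S : Type*} [Field K] [CommRing S] [IsNoetherianRing S]
    [Algebra K S] [Algebra.FiniteType K S] {n : ℕ} [Algebra (MvPolynomial (Fin n) K) S]
    [IsScalarTower K (MvPolynomial (Fin n) K) S] [Module.Flat (MvPolynomial (Fin n) K) S]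
    (hdim : ringKrullDim S ≤ n) : IsCohenMacaulayRing S := by
  refine ⟨inferInstance, fun m hm ↦ ?_⟩
  let θ : Fin n → S := fun i ↦ algebraMap _ S (X i : MvPolynomial (Fin n) K)
  have hp : ∀ i, ∃ p : Polynomial K, p.Monic ∧ Polynomial.aeval (θ i) p ∈ m := fun i ↦ by
    let _ := Ideal.Quotient.field m
    have : Module.Finite K (S ⧸ m) := finite_of_finite_type_of_isJacobsonRing K (S ⧸ m)
    have hint : IsIntegral K (Ideal.Quotient.mk m (θ i)) := IsIntegral.of_finite K _
    refine ⟨_, minpoly.monic hint, ?_⟩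
    rw [← Ideal.Quotient.eq_zero_iff_mem]
    have := minpoly.aeval K (Ideal.Quotient.mk m (θ i))
    rw [← this]
    exact (Polynomial.aeval_algHom_apply (Ideal.Quotient.mkₐ K m) (θ i) _).symm
  choose p hmonic hmem using hp
  set L := Localization.AtPrime m
  set rs : List S := (List.ofFn fun i ↦ Polynomial.aeval (X i : MvPolynomial (Fin n) K) (p i)).map
    (algebraMap _ S) with hrs
  have hwr : RingTheory.Sequence.IsWeaklyRegular S rs :=
    (isWeaklyRegular_ofFn_aeval_X p hmonic).of_flat
  have hrsm : ∀ r ∈ rs, r ∈ m := by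
    simp only [hrs, List.map_ofFn, List.mem_ofFn]
    rintro _ ⟨i, rfl⟩
    have := hmem i
    rwa [Polynomial.aeval_algebraMap_apply] at this
  have hreg : RingTheory.Sequence.IsRegular L (rs.map (algebraMap S L)) :=
    hwr.isRegular_of_isLocalization_of_mem L m hrsm
  have hlen : ∀ ts : List L, RingTheory.Sequence.IsRegular L ts →
      (ts.length : WithBot ℕ∞) ≤ ringKrullDim L := fun ts hts ↦ by
    rw [← ringKrullDim_add_length_eq_ringKrullDim_of_isRegular ts hts]
    have : Nontrivial (L ⧸ Ideal.ofList ts) := Ideal.Quotient.nontrivial_iff.2 fun h ↦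
      hts.top_ne_smul (by simp [h])
    exact le_add_of_nonneg_left ringKrullDim_nonneg_of_nontrivial
  have hdimL : ringKrullDim L = n := by
    refine le_antisymm ?_ (by simpa [hrs] using hlen _ hreg)
    rw [IsLocalization.AtPrime.ringKrullDim_eq_height m L]
    exact Ideal.height_le_ringKrullDim_of_isPrime.trans hdim
  rw [hdimL]
  have : localRingDepth L = n := by
    refine le_antisymm (iSup₂_le fun ts hts ↦ ?_) ?_
    · have := (hlen ts hts.2).trans_eq hdimL
      exact_mod_cast this
    · refine le_iSup₂_of_le (rs.map (algebraMap S L)) ⟨?_, hreg⟩ (by simp [hrs])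
      intro r hr
      obtain ⟨t, ht, rfl⟩ := List.mem_map.1 hr
      exact (IsLocalization.AtPrime.to_map_mem_maximal_iff L m t).2 (hrsm t ht)
  rw [this]
  rfl

/-! ### Freeness of the quotient over a polynomial subring -/

/-- If `K₁ = (I : x)` and `K₂ = I + (x)`, then the exact sequence `0 → A/K₁ → A/I → A/K₂ → 0`
splits over `B` as soon as `A/K₂` is free. -/
theorem free_quotient_of_colon_of_sup {B A : Type*} [CommRing B] [CommRing A] [Algebra B A]
    {I K₁ K₂ : Ideal A} {x : A} (hcolon : ∀ a, x * a ∈ I ↔ a ∈ K₁) (hsup : K₂ = I ⊔ Ideal.span {x})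
    [Module.Free B (A ⧸ K₁)] [Module.Free B (A ⧸ K₂)] : Module.Free B (A ⧸ I) := by
  let f : (A ⧸ K₁) →ₗ[B] (A ⧸ I) :=
    (Submodule.mapQ K₁ I (LinearMap.mulLeft A x) fun a ha ↦ (hcolon a).2 ha).restrictScalars B
  let g : (A ⧸ I) →ₗ[B] (A ⧸ K₂) :=
    (Submodule.mapQ I K₂ LinearMap.id (hsup ▸ le_sup_left)).restrictScalars B
  have hf : Function.Injective f := by
    rw [injective_iff_map_eq_zero]
    intro a
    obtain ⟨a, rfl⟩ := Submodule.Quotient.mk_surjective _ a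
    intro h
    exact (Submodule.Quotient.mk_eq_zero _).2
      ((hcolon a).1 ((Submodule.Quotient.mk_eq_zero I (x := x * a)).1 h))
  have hg : Function.Surjective g := by
    intro a
    obtain ⟨a, rfl⟩ := Submodule.Quotient.mk_surjective _ a
    exact ⟨Submodule.Quotient.mk a, rfl⟩
  have hfg : Function.Exact f g := by
    intro a
    obtain ⟨a, rfl⟩ := Submodule.Quotient.mk_surjective _ a
    have h₁ : g (Submodule.Quotient.mk a) = 0 ↔ a ∈ K₂ := Submodule.Quotient.mk_eq_zero K₂
    rw [h₁, hsup]
    constructor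
    · intro h
      obtain ⟨i, hi, _, hj, rfl⟩ := Submodule.mem_sup.1 h
      obtain ⟨b, rfl⟩ := Ideal.mem_span_singleton.1 hj
      refine ⟨Submodule.Quotient.mk b, (Submodule.Quotient.eq I (x := x * b)).2 ?_⟩
      rw [sub_add_cancel_right]
      exact I.neg_mem hi
    · rintro ⟨b, hb⟩
      obtain ⟨b, rfl⟩ := Submodule.Quotient.mk_surjective _ b
      have h₂ := (Submodule.Quotient.eq I (x := x * b)).1 hb
      have h₃ : a = -(x * b - a) + x * b := by ring
      rw [h₃]
      exact Ideal.add_mem _ (Ideal.mem_sup_left (I.neg_mem h₂))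
        (Ideal.mem_sup_right (Ideal.mul_mem_right _ _ (Ideal.mem_span_singleton_self x)))
  obtain ⟨l, hl⟩ := Module.projective_lifting_property g LinearMap.id hg
  exact Module.Free.of_equiv (hfg.splitSurjectiveEquiv hf ⟨l, hl⟩).1.symm

local notation "𝐁" => MvPolynomial (Fin 5) ℚ
local notation "𝐭₀" => (X 0 : MvPolynomial (Fin 5) ℚ)
local notation "𝐭₁" => (X 1 : MvPolynomial (Fin 5) ℚ)
local notation "𝐭₂" => (X 2 : MvPolynomial (Fin 5) ℚ)
local notation "𝐭₃" => (X 3 : MvPolynomial (Fin 5) ℚ)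
local notation "𝐭₄" => (X 4 : MvPolynomial (Fin 5) ℚ)

/-- The homomorphism from the polynomial ring in five variables that sends them to the parameters
`a - y, b - y, c - z, d + z, x + y - z`. The sign in `d + z` makes the leading coefficient of
`ab - cd` in `z` modulo `x` equal to `2`; it would vanish for `d - z`. -/
noncomputable def parameters : MvPolynomial (Fin 5) ℚ →ₐ[ℚ] MvPolynomial (Fin 7) ℚ :=
  aeval ![𝐚 - 𝐲, 𝐛 - 𝐲, 𝐜 - 𝐳, 𝐝 + 𝐳, 𝐱 + 𝐲 - 𝐳]

/-- The cubic `Y (Y + t₀) (Y + t₁)`, which is `yab` written in the parameters. -/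
noncomputable def leftCubic : Polynomial 𝐁 :=
  Polynomial.X * (Polynomial.X + Polynomial.C 𝐭₀) * (Polynomial.X + Polynomial.C 𝐭₁)

/-- The cubic `Z (Z + t₂) (Z - t₃)`, which is `-zcd` written in the parameters. -/
noncomputable def rightCubic : Polynomial (AdjoinRoot leftCubic) :=
  Polynomial.X * (Polynomial.X + Polynomial.C (algebraMap _ _ 𝐭₂)) *
    (Polynomial.X - Polynomial.C (algebraMap _ _ 𝐭₃))

/-- The monic quartic in `z` that is half of `yz(ab - cd)` modulo `x`, written in the parameters. -/
noncomputable def quartic : Polynomial 𝐁 :=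
  Polynomial.X * (Polynomial.X + Polynomial.C 𝐭₄) *
    (Polynomial.X ^ 2 + (Polynomial.C (C (1 / 2) * (𝐭₀ + 𝐭₁ + 𝐭₂ - 𝐭₃ + 2 * 𝐭₄)) * Polynomial.X +
      Polynomial.C (C (1 / 2) * ((𝐭₀ + 𝐭₄) * (𝐭₁ + 𝐭₄) - 𝐭₂ * 𝐭₃))))

theorem monic_leftCubic : leftCubic.Monic :=
  (Polynomial.monic_X.mul (Polynomial.monic_X_add_C _)).mul (Polynomial.monic_X_add_C _)

theorem monic_rightCubic : rightCubic.Monic :=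
  (Polynomial.monic_X.mul (Polynomial.monic_X_add_C _)).mul (Polynomial.monic_X_sub_C _)

theorem monic_quartic : quartic.Monic :=
  (Polynomial.monic_X.mul (Polynomial.monic_X_add_C _)).mul
    (Polynomial.monic_X_pow_add ((Polynomial.degree_linear_le).trans_lt (by norm_num)))

theorem eval₂_leftCubic {R : Type*} [CommRing R] (f : 𝐁 →+* R) (r : R) :
    leftCubic.eval₂ f r = r * (r + f 𝐭₀) * (r + f 𝐭₁) := by
  simp [leftCubic, Polynomial.eval₂_mul]

theorem eval₂_rightCubic {R : Type*} [CommRing R] (f : AdjoinRoot leftCubic →+* R) (r : R) :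
    rightCubic.eval₂ f r = r * (r + f (algebraMap _ _ 𝐭₂)) * (r - f (algebraMap _ _ 𝐭₃)) := by
  simp [rightCubic, Polynomial.eval₂_mul]

theorem eval₂_quartic_eq_zero_iff {R : Type*} [CommRing R] (f : 𝐁 →+* R) (r : R) :
    quartic.eval₂ f r = 0 ↔ (r + f 𝐭₄) * r *
      ((r + f 𝐭₄ + f 𝐭₀) * (r + f 𝐭₄ + f 𝐭₁) - (r + f 𝐭₂) * (f 𝐭₃ - r)) = 0 := by
  have h2 : f (C (1 / 2)) * 2 = 1 := by
    rw [← map_ofNat f 2, ← map_mul, ← map_ofNat C 2, ← map_mul]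
    norm_num
  have h : quartic.eval₂ f r = r * (r + f 𝐭₄) *
      (r ^ 2 + (f (C (1 / 2)) * (f 𝐭₀ + f 𝐭₁ + f 𝐭₂ - f 𝐭₃ + 2 * f 𝐭₄) * r +
        f (C (1 / 2)) * ((f 𝐭₀ + f 𝐭₄) * (f 𝐭₁ + f 𝐭₄) - f 𝐭₂ * f 𝐭₃))) := by
    simp only [quartic, Polynomial.eval₂_mul, Polynomial.eval₂_add, Polynomial.eval₂_X,
      Polynomial.eval₂_C, Polynomial.eval₂_pow, map_mul f, map_sub f, map_add f, map_ofNat f]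
  generalize f (C (1 / 2)) = η at h h2
  rw [h]
  constructor
  · intro h₀
    linear_combination 2 * h₀ - r * (r + f 𝐭₄) * ((f 𝐭₀ + f 𝐭₁ + f 𝐭₂ - f 𝐭₃ + 2 * f 𝐭₄) * r +
      ((f 𝐭₀ + f 𝐭₄) * (f 𝐭₁ + f 𝐭₄) - f 𝐭₂ * f 𝐭₃)) * h2
  · intro h₀
    linear_combination η * h₀ - r ^ 3 * (r + f 𝐭₄) * h2

theorem ringHom_ext_of_X {σ R : Type*} [CommRing R] {f g : MvPolynomial σ ℚ →+* R}
    (h : ∀ i, f (X i) = g (X i)) : f = g :=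
  MvPolynomial.ringHom_ext
    (fun q ↦ DFunLike.congr_fun (Subsingleton.elim (f.comp C) (g.comp C)) q) h

/-- A homomorphism `ψ` to a quotient of the polynomial ring is bijective if it has a left inverse
that is induced by a homomorphism `φ`, and `ψ ∘ φ` fixes the variables. -/
theorem bijective_of_lift_comp_eq_id {σ S : Type*} [CommRing S] {K : Ideal (MvPolynomial σ ℚ)}
    (ψ : S →+* MvPolynomial σ ℚ ⧸ K) (φ : MvPolynomial σ ℚ →+* S) (hφ : ∀ k ∈ K, φ k = 0)
    (h₁ : ∀ i, ψ (φ (X i)) = Ideal.Quotient.mk K (X i))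
    (h₂ : (Ideal.Quotient.lift K φ hφ).comp ψ = RingHom.id S) : Function.Bijective ψ := by
  refine ⟨Function.LeftInverse.injective (g := Ideal.Quotient.lift K φ hφ)
    fun s ↦ DFunLike.congr_fun h₂ s, fun a ↦ ?_⟩
  obtain ⟨a, rfl⟩ := Ideal.Quotient.mk_surjective a
  have h : ψ.comp φ = Ideal.Quotient.mk K :=
    ringHom_ext_of_X h₁
  exact ⟨φ a, DFunLike.congr_fun h a⟩

/-- Modulo `x`, the parameters express the variables other than `z` through `z`, so that the
quotient by `(x, yz(ab - cd))` arises by adjoining a root of `quartic`. -/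
theorem exists_bijective_quartic :
    ∃ ψ : AdjoinRoot quartic →+* MvPolynomial (Fin 7) ℚ ⧸ Ideal.span {𝐱, 𝐲 * 𝐳 * 𝐰},
      ψ.comp (algebraMap 𝐁 _) = (Ideal.Quotient.mk _).comp parameters.toRingHom ∧
        Function.Bijective ψ := by
  set K := Ideal.span {𝐱, 𝐲 * 𝐳 * 𝐰} with hK
  set r : AdjoinRoot quartic := AdjoinRoot.root quartic with hr
  set i := algebraMap 𝐁 (AdjoinRoot quartic) with hi
  have hx : Ideal.Quotient.mk K 𝐱 = 0 :=
    Ideal.Quotient.eq_zero_iff_mem.2 (Ideal.subset_span (by simp))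
  have hw : Ideal.Quotient.mk K (𝐲 * 𝐳 * 𝐰) = 0 :=
    Ideal.Quotient.eq_zero_iff_mem.2 (Ideal.subset_span (by simp))
  have hlift : quartic.eval₂ ((Ideal.Quotient.mk K).comp parameters.toRingHom)
      (Ideal.Quotient.mk K 𝐳) = 0 := by
    rw [eval₂_quartic_eq_zero_iff, ← hw]
    simp only [parameters, AlgHom.toRingHom_eq_coe, RingHom.comp_apply, RingHom.coe_coe, aeval_X,
      Matrix.cons_val, map_add, map_sub, map_mul, hx]
    ring
  let ψ : AdjoinRoot quartic →+* MvPolynomial (Fin 7) ℚ ⧸ K := AdjoinRoot.lift _ _ hlift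
  have hψ : ψ.comp i = (Ideal.Quotient.mk K).comp parameters.toRingHom :=
    RingHom.ext fun b ↦ AdjoinRoot.lift_of hlift
  have hψr : ψ r = Ideal.Quotient.mk K 𝐳 := AdjoinRoot.lift_root hlift
  let φ : MvPolynomial (Fin 7) ℚ →ₐ[ℚ] AdjoinRoot quartic :=
    aeval ![0, r + i 𝐭₄, r, r + i 𝐭₄ + i 𝐭₀, r + i 𝐭₄ + i 𝐭₁, r + i 𝐭₂, i 𝐭₃ - r]
  have hφ : ∀ k ∈ K, φ.toRingHom k = 0 := by
    have h₀ := (eval₂_quartic_eq_zero_iff i r).1 (AdjoinRoot.eval₂_root quartic)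
    intro k hk
    obtain ⟨m, n, rfl⟩ := Ideal.mem_span_pair.1 hk
    simp [φ, h₀]
  have hψ' : ∀ b, ψ (i b) = Ideal.Quotient.mk K (parameters b) := DFunLike.congr_fun hψ
  refine ⟨ψ, hψ, bijective_of_lift_comp_eq_id ψ φ.toRingHom hφ (fun j ↦ ?_) ?_⟩
  · fin_cases j <;> simp [φ, hψ', hψr, parameters, hx]
  · refine AdjoinRoot.ringHom_ext (ringHom_ext_of_X fun j ↦ ?_) ?_
    · change Ideal.Quotient.lift K φ.toRingHom hφ (ψ (i (X j))) = i (X j)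
      rw [hψ', Ideal.Quotient.lift_mk]
      fin_cases j <;> simp [parameters, φ]
    · change Ideal.Quotient.lift K φ.toRingHom hφ (ψ r) = r
      rw [hψr, Ideal.Quotient.lift_mk]
      simp [φ]

/-- The parameters express the variables other than `y` and `z` through `y` and `z`, so that the
quotient by `(yab, zcd)` arises by adjoining a root of `leftCubic` and then one of `rightCubic`. -/
theorem exists_bijective_rightCubic :
    ∃ ψ : AdjoinRoot rightCubic →+* MvPolynomial (Fin 7) ℚ ⧸ Ideal.span {𝐲 * 𝐚 * 𝐛, 𝐳 * 𝐜 * 𝐝},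
      ψ.comp (algebraMap 𝐁 _) = (Ideal.Quotient.mk _).comp parameters.toRingHom ∧
        Function.Bijective ψ := by
  set K := Ideal.span {𝐲 * 𝐚 * 𝐛, 𝐳 * 𝐜 * 𝐝} with hK
  set s : AdjoinRoot leftCubic := AdjoinRoot.root leftCubic with hs
  set r : AdjoinRoot rightCubic := AdjoinRoot.root rightCubic with hr
  set i₁ := algebraMap 𝐁 (AdjoinRoot leftCubic) with hi₁
  set i₂ := algebraMap (AdjoinRoot leftCubic) (AdjoinRoot rightCubic) with hi₂
  have hi : algebraMap 𝐁 (AdjoinRoot rightCubic) = i₂.comp i₁ := IsScalarTower.algebraMap_eq _ _ _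
  have hl : Ideal.Quotient.mk K (𝐲 * 𝐚 * 𝐛) = 0 :=
    Ideal.Quotient.eq_zero_iff_mem.2 (Ideal.subset_span (by simp))
  have hr' : Ideal.Quotient.mk K (𝐳 * 𝐜 * 𝐝) = 0 :=
    Ideal.Quotient.eq_zero_iff_mem.2 (Ideal.subset_span (by simp))
  have hlift₁ : leftCubic.eval₂ ((Ideal.Quotient.mk K).comp parameters.toRingHom)
      (Ideal.Quotient.mk K 𝐲) = 0 := by
    rw [eval₂_leftCubic, ← hl]
    simp [parameters]
  let ψ₁ : AdjoinRoot leftCubic →+* MvPolynomial (Fin 7) ℚ ⧸ K := AdjoinRoot.lift _ _ hlift₁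
  have hψ₁ : ∀ b, ψ₁ (i₁ b) = Ideal.Quotient.mk K (parameters b) := fun b ↦
    AdjoinRoot.lift_of hlift₁
  have hψs : ψ₁ s = Ideal.Quotient.mk K 𝐲 := AdjoinRoot.lift_root hlift₁
  have hlift₂ : rightCubic.eval₂ ψ₁ (Ideal.Quotient.mk K 𝐳) = 0 := by
    have hneg : -Ideal.Quotient.mk K (𝐳 * 𝐜 * 𝐝) = 0 := by rw [hr', neg_zero]
    rw [eval₂_rightCubic, hψ₁, hψ₁, ← hneg]
    simp [parameters]
    ring
  let ψ : AdjoinRoot rightCubic →+* MvPolynomial (Fin 7) ℚ ⧸ K := AdjoinRoot.lift _ _ hlift₂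
  have hψ₂ : ∀ b, ψ (i₂ b) = ψ₁ b := fun b ↦ AdjoinRoot.lift_of hlift₂
  have hψr : ψ r = Ideal.Quotient.mk K 𝐳 := AdjoinRoot.lift_root hlift₂
  let t : Fin 5 → AdjoinRoot rightCubic := fun j ↦ i₂ (i₁ (X j))
  let φ : MvPolynomial (Fin 7) ℚ →ₐ[ℚ] AdjoinRoot rightCubic :=
    aeval ![t 4 - i₂ s + r, i₂ s, r, i₂ s + t 0, i₂ s + t 1, r + t 2, t 3 - r]
  have hφ : ∀ k ∈ K, φ.toRingHom k = 0 := by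
    have h₁ : i₂ s * (i₂ s + t 0) * (i₂ s + t 1) = 0 := by
      have h := congrArg i₂ (AdjoinRoot.eval₂_root leftCubic)
      rw [eval₂_leftCubic] at h
      simp only [map_mul, map_add, map_zero] at h
      exact h
    have h₂ : r * (r + t 2) * (r - t 3) = 0 := by
      have h := AdjoinRoot.eval₂_root rightCubic
      rwa [eval₂_rightCubic] at h
    intro k hk
    obtain ⟨m, n, rfl⟩ := Ideal.mem_span_pair.1 hk
    simp only [φ, AlgHom.toRingHom_eq_coe, RingHom.coe_coe, map_add, map_mul, aeval_X,
      Matrix.cons_val]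
    linear_combination aeval _ m * h₁ - aeval _ n * h₂
  refine ⟨ψ, ?_, bijective_of_lift_comp_eq_id ψ φ.toRingHom hφ (fun j ↦ ?_) ?_⟩
  · rw [hi]
    exact RingHom.ext fun b ↦ (hψ₂ _).trans (hψ₁ b)
  · fin_cases j <;> simp [φ, t, hψ₂, hψ₁, hψr, hψs, parameters]
    ring
  · refine AdjoinRoot.ringHom_ext (AdjoinRoot.ringHom_ext (ringHom_ext_of_X fun j ↦ ?_) ?_) ?_
    · change Ideal.Quotient.lift K φ.toRingHom hφ (ψ (i₂ (i₁ (X j)))) = t j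
      rw [hψ₂, hψ₁, Ideal.Quotient.lift_mk]
      fin_cases j <;> simp [parameters, φ]
      ring
    · change Ideal.Quotient.lift K φ.toRingHom hφ (ψ (i₂ s)) = i₂ s
      rw [hψ₂, hψs, Ideal.Quotient.lift_mk]
      simp [φ]
    · change Ideal.Quotient.lift K φ.toRingHom hφ (ψ r) = r
      rw [hψr, Ideal.Quotient.lift_mk]
      simp [φ]

/-- The transport of freeness along an isomorphism of algebras that is given as a ring
homomorphism. -/
theorem free_of_bijective {B S T : Type*} [CommRing B] [CommRing S] [CommRing T] [Algebra B S]
    [Algebra B T] [Module.Free B S] (ψ : S →+* T) (hψ : ψ.comp (algebraMap B S) = algebraMap B T)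
    (hbij : Function.Bijective ψ) : Module.Free B T :=
  .of_equiv (AlgEquiv.ofBijective
    ({ ψ with commutes' := DFunLike.congr_fun hψ } : S →ₐ[B] T) hbij).toLinearEquiv

/-- A chain of primes containing `I` is extended downwards by a chain of length `n`. -/
theorem ringKrullDim_quotient_le_of_le_height {R : Type*} [CommRing R] {I : Ideal R} {n N : ℕ}
    (hI : ∀ P : Ideal R, P.IsPrime → I ≤ P → n ≤ P.height) (hR : ringKrullDim R ≤ (n + N : ℕ)) :
    ringKrullDim (R ⧸ I) ≤ N := by
  refine iSup_le fun l ↦ ?_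
  let f : PrimeSpectrum (R ⧸ I) → PrimeSpectrum R := PrimeSpectrum.comap (Ideal.Quotient.mk I)
  have hf : StrictMono f :=
    Monotone.strictMono_of_injective (fun _ _ h ↦ Ideal.comap_mono h)
      (PrimeSpectrum.comap_injective_of_surjective _ Ideal.Quotient.mk_surjective)
  have hle : I ≤ (f l.head).asIdeal := fun a ha ↦ by
    rw [PrimeSpectrum.comap_asIdeal, Ideal.mem_comap, Ideal.Quotient.eq_zero_iff_mem.2 ha]
    exact zero_mem _
  have hn : (n : ℕ∞) ≤ Order.height (f l.head) := by
    rw [← PrimeSpectrum.height_eq_orderHeight]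
    exact hI _ inferInstance hle
  obtain ⟨q, hq, hqn⟩ := Order.exists_series_of_le_height _ hn
  have h := (Order.LTSeries.length_le_krullDim (q.smash (l.map f hf) (by simp [hq]))).trans hR
  have h' : q.length + l.length ≤ n + N := by
    exact_mod_cast h
  have h'' : l.length ≤ N := by omega
  exact_mod_cast h''

/-- The seven-variable polynomial ring as an algebra over the polynomial ring in the parameters. -/
@[reducible] noncomputable def parameterAlgebra : Algebra 𝐁 (MvPolynomial (Fin 7) ℚ) :=
  parameters.toAlgebra

attribute [local instance] parameterAlgebra

theorem x_mul_mem_exampleIdeal_iff (k : MvPolynomial (Fin 7) ℚ) :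
    𝐱 * k ∈ exampleIdeal ↔ k ∈ Ideal.span {𝐲 * 𝐚 * 𝐛, 𝐳 * 𝐜 * 𝐝} := by
  rw [mem_exampleIdeal_iff, Ideal.mem_span_pair]
  constructor
  · rintro ⟨α, β, γ, h⟩
    have hx : 𝐱 ∣ γ * (𝐲 * 𝐳 * 𝐰) :=
      ⟨k - α * (𝐲 * 𝐚 * 𝐛) - β * (𝐳 * 𝐜 * 𝐝), by linear_combination -h⟩
    have hx' : Prime 𝐱 := X_prime
    have hγ : 𝐱 ∣ γ := by
      refine (hx'.dvd_or_dvd hx).resolve_right fun h₁ ↦ ?_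
      have h₂ := (eval (![0, 1, 1, 1, 1, 0, 0] : Fin 7 → ℚ)).map_dvd h₁
      simp at h₂
    obtain ⟨γ, rfl⟩ := hγ
    refine ⟨α + γ * 𝐳, β - γ * 𝐲, ?_⟩
    refine mul_left_cancel₀ hx'.ne_zero ?_
    linear_combination -h
  · rintro ⟨α, β, rfl⟩
    exact ⟨α, β, 0, by ring⟩

theorem span_x_eq_sup :
    Ideal.span {𝐱, 𝐲 * 𝐳 * 𝐰} = exampleIdeal ⊔ Ideal.span {𝐱} := by
  refine le_antisymm ?_ (sup_le (fun h hh ↦ ?_) ?_)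
  · refine Ideal.span_le.2 (Set.pair_subset ?_ ?_)
    · exact Ideal.mem_sup_right (Ideal.mem_span_singleton_self _)
    · exact Ideal.mem_sup_left (mem_exampleIdeal_iff.2 ⟨0, 0, 1, by ring⟩)
  · obtain ⟨α, β, γ, rfl⟩ := mem_exampleIdeal_iff.1 hh
    exact Ideal.mem_span_pair.2 ⟨α * (𝐲 * 𝐚 * 𝐛) + β * (𝐳 * 𝐜 * 𝐝), γ, by ring⟩
  · exact Ideal.span_mono (Set.singleton_subset_iff.2 (Set.mem_insert _ _))

theorem free_quotient_exampleIdeal :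
    Module.Free 𝐁 (MvPolynomial (Fin 7) ℚ ⧸ exampleIdeal) := by
  have h₁ : Module.Free 𝐁 (MvPolynomial (Fin 7) ℚ ⧸ Ideal.span {𝐲 * 𝐚 * 𝐛, 𝐳 * 𝐜 * 𝐝}) := by
    obtain ⟨ψ, hψ, hbij⟩ := exists_bijective_rightCubic
    have := monic_leftCubic.free_adjoinRoot
    have := monic_rightCubic.free_adjoinRoot
    have := Module.Free.trans (R := 𝐁) (S := AdjoinRoot leftCubic) (M := AdjoinRoot rightCubic)
    exact free_of_bijective ψ hψ hbij
  have h₂ : Module.Free 𝐁 (MvPolynomial (Fin 7) ℚ ⧸ Ideal.span {𝐱, 𝐲 * 𝐳 * 𝐰}) := by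
    obtain ⟨ψ, hψ, hbij⟩ := exists_bijective_quartic
    have := monic_quartic.free_adjoinRoot
    exact free_of_bijective ψ hψ hbij
  exact free_quotient_of_colon_of_sup x_mul_mem_exampleIdeal_iff span_x_eq_sup

theorem isCohenMacaulayRing_quotient_exampleIdeal :
    IsCohenMacaulayRing (MvPolynomial (Fin 7) ℚ ⧸ exampleIdeal) := by
  have := free_quotient_exampleIdeal
  have : IsScalarTower ℚ 𝐁 (MvPolynomial (Fin 7) ℚ ⧸ exampleIdeal) :=
    ⟨fun q b r ↦ by
      obtain ⟨r, rfl⟩ := Submodule.Quotient.mk_surjective _ r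
      change Submodule.Quotient.mk (parameters (q • b) * r) =
        Submodule.Quotient.mk (q • (parameters b * r))
      rw [map_smul, smul_mul_assoc]⟩
  refine isCohenMacaulayRing_of_flat (K := ℚ) (n := 5) ?_
  refine ringKrullDim_quotient_le_of_le_height (n := 2)
    (fun P hP h ↦ two_le_height_of_exampleIdeal_le h) ?_
  rw [MvPolynomial.ringKrullDim_of_isNoetherianRing]
  simp

/-! ### Generators of the ideal and of its symbolic square -/

theorem card_support_mul_X {σ R : Type*} [CommSemiring R] (p : MvPolynomial σ R) (i : σ) :
    (p * X i).support.card = p.support.card := by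
  rw [support_mul_X, Finset.card_map]

/-- The three generators of the ideal. -/
noncomputable def exampleGenerator : Fin 3 → MvPolynomial (Fin 7) ℚ :=
  ![𝐱 * 𝐲 * 𝐚 * 𝐛, 𝐱 * 𝐳 * 𝐜 * 𝐝, 𝐲 * 𝐳 * 𝐰]

theorem span_range_exampleGenerator : Ideal.span (Set.range exampleGenerator) = exampleIdeal := by
  rw [exampleIdeal_eq, exampleGenerator, Matrix.range_cons, Matrix.range_cons, Matrix.range_cons,
    Matrix.range_empty, Set.union_empty]
  rfl

theorem isHomogeneous_exampleGenerator (i : Fin 3) : (exampleGenerator i).IsHomogeneous 4 := by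
  have h (j : Fin 7) : (X j : MvPolynomial (Fin 7) ℚ).IsHomogeneous 1 := isHomogeneous_X ℚ j
  fin_cases i
  · exact (((h 0).mul (h 1)).mul (h 3)).mul (h 4)
  · exact (((h 0).mul (h 2)).mul (h 5)).mul (h 6)
  · exact ((h 1).mul (h 2)).mul (((h 3).mul (h 4)).sub ((h 5).mul (h 6)))

theorem card_support_exampleGenerator_le (i : Fin 3) : (exampleGenerator i).support.card ≤ 2 := by
  have h (j : Fin 7) : (X j : MvPolynomial (Fin 7) ℚ).support.card = 1 := by
    rw [support_X, Finset.card_singleton]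
  fin_cases i
  · simp [exampleGenerator, h]
  · simp [exampleGenerator, h]
  · have h₁ : 𝐲 * 𝐳 * 𝐰 = 𝐰 * 𝐲 * 𝐳 := by ring
    change (𝐲 * 𝐳 * 𝐰).support.card ≤ 2
    rw [h₁, card_support_mul_X, card_support_mul_X]
    refine (Finset.card_le_card (support_sub _ _ _)).trans ((Finset.card_union_le _ _).trans ?_)
    rw [card_support_mul_X, card_support_mul_X, h, h]

theorem isBinomialIdeal_exampleIdeal : IsBinomialIdeal exampleIdeal :=
  ⟨_, Set.forall_mem_range.2 card_support_exampleGenerator_le, span_range_exampleGenerator⟩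

theorem isGeneratedInDegree_exampleIdeal : IsGeneratedInDegree exampleIdeal 4 :=
  ⟨_, Set.forall_mem_range.2 isHomogeneous_exampleGenerator, span_range_exampleGenerator⟩

theorem isHomogeneous_exampleForm : exampleForm.IsHomogeneous 9 := by
  have h (j : Fin 7) : (X j : MvPolynomial (Fin 7) ℚ).IsHomogeneous 1 := isHomogeneous_X ℚ j
  rw [exampleForm_eq]
  exact (((((((h 0).mul (h 1)).mul (h 2)).mul (h 3)).mul (h 4)).mul (h 5)).mul (h 6)).mul
    (((h 3).mul (h 4)).sub ((h 5).mul (h 6)))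

/-- The products of two generators together with the form of degree `9`. -/
def squareGenerators : Set (MvPolynomial (Fin 7) ℚ) :=
  insert exampleForm
    (Set.range fun k : Fin 3 × Fin 3 ↦ exampleGenerator k.1 * exampleGenerator k.2)

theorem span_range_mul_exampleGenerator :
    Ideal.span (Set.range fun k : Fin 3 × Fin 3 ↦ exampleGenerator k.1 * exampleGenerator k.2) =
      exampleIdeal ^ 2 := by
  rw [← span_range_exampleGenerator, sq, Ideal.span_mul_span', ← Set.image2_mul,
    Set.image2_range]

theorem span_squareGenerators :
    Ideal.span squareGenerators = symbolicPower exampleIdeal 2 := by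
  rw [symbolicPower_exampleIdeal_two, squareGenerators, Ideal.span_insert,
    span_range_mul_exampleGenerator, sup_comm]

theorem notMem_span_of_map_ne_zero {R R' : Type*} [CommRing R] [CommRing R'] (φ : R →+* R')
    {T : Set R} {g : R} (hT : ∀ h ∈ T, φ h = 0) (hg : φ g ≠ 0) : g ∉ Ideal.span T := fun h ↦
  hg ((Ideal.span_le (I := RingHom.ker φ)).2 hT h)

/-- The witness is the ring `ℚ[ε₁, …, εₙ] / (ε₁², …, εₙ²)`, built as an iterated ring of dual
numbers. -/
theorem exists_sq_zero_prod_ne_zero (n : ℕ) :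
    ∃ (R : Type) (_ : CommRing R) (_ : Algebra ℚ R) (e : Fin n → R),
      (∀ i, e i * e i = 0) ∧ ∏ i, e i ≠ 0 := by
  induction n with
  | zero => exact ⟨ℚ, inferInstance, inferInstance, Fin.elim0, fun i ↦ i.elim0, by simp⟩
  | succ n ih =>
    obtain ⟨R, _, _, e, he, hne⟩ := ih
    refine ⟨DualNumber R, inferInstance, inferInstance,
      Fin.cons DualNumber.eps fun i ↦ TrivSqZeroExt.inl (e i), fun i ↦ ?_, ?_⟩
    · refine i.cases ?_ fun i ↦ ?_
      · rw [Fin.cons_zero]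
        exact DualNumber.eps_mul_eps
      · rw [Fin.cons_succ, ← TrivSqZeroExt.inl_mul, he, TrivSqZeroExt.inl_zero]
    · rw [Fin.prod_univ_succ, Fin.cons_zero]
      simp only [Fin.cons_succ]
      intro h
      refine hne ?_
      have h' := congrArg TrivSqZeroExt.snd h
      rw [DualNumber.snd_mul, DualNumber.fst_eps, DualNumber.snd_eps, zero_mul, one_mul, zero_add,
        TrivSqZeroExt.snd_zero] at h'
      rw [← h']
      exact (map_prod (TrivSqZeroExt.fstHom R R R) (fun i ↦ TrivSqZeroExt.inl (e i))
        Finset.univ).symm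

/-- A product of two generators is separated from the other products and from the form by a point
with values in a ring with elements `ε`, `η` of square zero and nonzero product: for the square of
a generator, by a rational point at which the other two vanish; for the product of two different
generators, by a point at which they take the values `ε` and `η` up to sign, and the third one
vanishes. -/
theorem exists_separating_hom (i j : Fin 3) :
    ∃ (R : Type) (_ : CommRing R) (φ : MvPolynomial (Fin 7) ℚ →+* R), φ exampleForm = 0 ∧
      φ (exampleGenerator i * exampleGenerator j) ≠ 0 ∧
      ∀ k l, φ (exampleGenerator k * exampleGenerator l) ≠ 0 → s(k, l) = s(i, j) := by
  wlog hij : i ≤ j generalizing i j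
  · rw [mul_comm, Sym2.eq_swap]
    exact this j i (le_of_not_ge hij)
  obtain ⟨R, _, _, e, he, hne⟩ := exists_sq_zero_prod_ne_zero 2
  obtain ⟨p, q, hp, hq, hpq⟩ : ∃ p q : R, p * p = 0 ∧ q * q = 0 ∧ p * q ≠ 0 :=
    ⟨e 0, e 1, he 0, he 1, by simpa [Fin.prod_univ_two] using hne⟩
  have : Nontrivial R := ⟨_, _, hpq⟩
  have hφ (v : Fin 7 → R) (w : Fin 3 → R)
      (hw : ![v 0 * v 1 * v 3 * v 4, v 0 * v 2 * v 5 * v 6,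
        v 1 * v 2 * (v 3 * v 4 - v 5 * v 6)] = w) (k : Fin 3) :
      aeval (R := ℚ) v (exampleGenerator k) = w k := by
    subst hw
    fin_cases k <;> simp [exampleGenerator]
  have hf (v : Fin 7 → R) : aeval (R := ℚ) v exampleForm =
      v 0 * v 1 * v 2 * v 3 * v 4 * v 5 * v 6 * (v 3 * v 4 - v 5 * v 6) := by
    simp [exampleForm_eq]
  suffices ∃ (v : Fin 7 → R) (w : Fin 3 → R),
      ![v 0 * v 1 * v 3 * v 4, v 0 * v 2 * v 5 * v 6, v 1 * v 2 * (v 3 * v 4 - v 5 * v 6)] = w ∧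
      v 0 * v 1 * v 2 * v 3 * v 4 * v 5 * v 6 * (v 3 * v 4 - v 5 * v 6) = 0 ∧ w i * w j ≠ 0 ∧
      ∀ k l, w k * w l ≠ 0 → s(k, l) = s(i, j) by
    obtain ⟨v, w, hw, h₁, h₂, h₃⟩ := this
    refine ⟨R, inferInstance, (aeval (R := ℚ) v).toRingHom, (hf v).trans h₁, ?_⟩
    simpa [hφ v w hw] using And.intro h₂ h₃
  fin_cases i <;> fin_cases j <;> simp at hij
  · refine ⟨![1, 1, 0, 1, 1, 1, 1], ![1, 0, 0], by simp, by simp, by simp, fun k l ↦ ?_⟩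
    fin_cases k <;> fin_cases l <;> simp
  · refine ⟨![1, p, q, 1, 1, 1, 1], ![p, q, 0], by simp, by simp, by simpa, fun k l ↦ ?_⟩
    fin_cases k <;> fin_cases l <;> simp [hp, hq]
  · refine ⟨![p, 1, q, 1, 1, 0, 1], ![p, 0, q], by simp, by simp, by simpa, fun k l ↦ ?_⟩
    fin_cases k <;> fin_cases l <;> simp [hp, hq]
  · refine ⟨![1, 0, 1, 1, 1, 1, 1], ![0, 1, 0], by simp, by simp, by simp, fun k l ↦ ?_⟩
    fin_cases k <;> fin_cases l <;> simp
  · refine ⟨![p, q, 1, 0, 1, 1, 1], ![0, p, -q], by simp, by simp, by simpa, fun k l ↦ ?_⟩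
    fin_cases k <;> fin_cases l <;> simp [hp, hq]
  · refine ⟨![0, 1, 1, 1, 1, 0, 1], ![0, 0, 1], by simp, by simp, by simp, fun k l ↦ ?_⟩
    fin_cases k <;> fin_cases l <;> simp

theorem exampleForm_notMem_sq_exampleIdeal : exampleForm ∉ exampleIdeal ^ 2 := by
  -- At a point `(p, q, r, 1, 1, 1, 2)` with `p² = q² = r² = 0`, any two generators have product
  -- zero, whereas the form takes the value `-2pqr`.
  obtain ⟨R, _, _, e, he, hne⟩ := exists_sq_zero_prod_ne_zero 3
  obtain ⟨p, q, r, hp, hq, hr, hpqr⟩ :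
      ∃ p q r : R, p * p = 0 ∧ q * q = 0 ∧ r * r = 0 ∧ p * q * r ≠ 0 :=
    ⟨e 0, e 1, e 2, he 0, he 1, he 2, by simpa [Fin.prod_univ_three] using hne⟩
  let v : Fin 7 → R := ![p, q, r, 1, 1, 1, 2]
  have hg (k : Fin 3) : aeval (R := ℚ) v (exampleGenerator k) =
      ![p * q, 2 * (p * r), -(q * r)] k := by
    fin_cases k <;> simp [exampleGenerator, v] <;> ring
  rw [← span_range_mul_exampleGenerator]
  refine notMem_span_of_map_ne_zero (aeval (R := ℚ) v).toRingHom ?_ ?_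
  · rintro _ ⟨⟨k, l⟩, rfl⟩
    change aeval (R := ℚ) v (exampleGenerator k * exampleGenerator l) = 0
    rw [map_mul, hg, hg]
    fin_cases k <;> fin_cases l <;>
      simp only [Fin.zero_eta, Fin.mk_one, Fin.reduceFinMk, Matrix.cons_val]
    · linear_combination q * q * hp
    · linear_combination 2 * q * r * hp
    · linear_combination - p * r * hq
    · linear_combination 2 * q * r * hp
    · linear_combination 4 * r * r * hp
    · linear_combination - 2 * p * q * hr
    · linear_combination - p * r * hq
    · linear_combination - 2 * p * q * hr
    · linear_combination r * r * hq
  · have h : aeval (R := ℚ) v exampleForm = (-2 : ℚ) • (p * q * r) := by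
      rw [Algebra.smul_def, map_neg, map_ofNat]
      simp [exampleForm_eq, v]
      ring
    change aeval (R := ℚ) v exampleForm ≠ 0
    rw [h]
    exact smul_ne_zero (by norm_num) hpqr

theorem span_diff_singleton_ne {R : Type*} [CommRing R] {S : Set R} {g : R} {J : Ideal R}
    (hJ : Ideal.span S = J) (hS : g ∈ S) (hg : g ∉ Ideal.span (S \ {g})) :
    Ideal.span (S \ {g}) ≠ J :=
  fun h ↦ hg (h ▸ hJ ▸ Ideal.subset_span hS)

theorem isMinimalGenerator_exampleForm :
    IsMinimalGenerator exampleForm (symbolicPower exampleIdeal 2) := by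
  refine ⟨squareGenerators, Set.mem_insert _ _, ?_, span_squareGenerators, fun g hg ↦
    span_diff_singleton_ne span_squareGenerators hg ?_⟩
  · rintro g (rfl | ⟨⟨i, j⟩, rfl⟩)
    · exact ⟨9, isHomogeneous_exampleForm⟩
    · exact ⟨8, (isHomogeneous_exampleGenerator i).mul (isHomogeneous_exampleGenerator j)⟩
  · obtain (rfl | ⟨⟨i, j⟩, rfl⟩) := hg
    · intro h
      refine exampleForm_notMem_sq_exampleIdeal (span_range_mul_exampleGenerator ▸
        Ideal.span_mono ?_ h)
      rintro g ⟨rfl | hg, hne⟩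
      · exact absurd rfl hne
      · exact hg
    · obtain ⟨R, _, φ, h₀, h₁, h₂⟩ := exists_separating_hom i j
      refine notMem_span_of_map_ne_zero φ ?_ h₁
      rintro g ⟨rfl | ⟨⟨k, l⟩, rfl⟩, hne⟩
      · exact h₀
      · by_contra h
        rcases Sym2.eq_iff.1 (h₂ k l h) with ⟨rfl, rfl⟩ | ⟨rfl, rfl⟩
        · exact hne rfl
        · exact hne (mul_comm _ _)

attribute [local instance] MvPolynomial.gradedAlgebra

/-- A form `f` of degree `e` that is not in the homogeneous ideal `I` is needed to generate `I +
(f)`: all forms of degree less than `e` in the latter ideal lie in `I`. -/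
theorem not_isGeneratedInDegreesLE_sup_span_singleton {σ K : Type*} [Field K]
    {I : Ideal (MvPolynomial σ K)} (hI : I.IsHomogeneous (homogeneousSubmodule σ K))
    {f : MvPolynomial σ K} {e D : ℕ} (hf : f.IsHomogeneous e) (hfI : f ∉ I) (hD : D < e) :
    ¬ IsGeneratedInDegreesLE (I ⊔ Ideal.span {f}) D := by
  rintro ⟨S, hS, hspan⟩
  have hle : Ideal.span S ≤ I := by
    refine Ideal.span_le.2 fun g hg ↦ ?_
    obtain ⟨d, hd, hgd⟩ := hS g hg
    have hg' : g ∈ I ⊔ Ideal.span {f} := hspan ▸ Ideal.subset_span hg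
    obtain ⟨q, hq, _, hc, rfl⟩ := Submodule.mem_sup.1 hg'
    obtain ⟨c, rfl⟩ := Ideal.mem_span_singleton'.1 hc
    have h₁ : (DirectSum.decompose (homogeneousSubmodule σ K) (c * f) d : MvPolynomial σ K) = 0 :=
      DirectSum.coe_decompose_mul_of_right_mem_of_not_le _ hf (by omega)
    have h₂ := DirectSum.decompose_of_mem_same (homogeneousSubmodule σ K) hgd
    rw [DirectSum.decompose_add, DirectSum.add_apply, Submodule.coe_add, h₁, add_zero] at h₂
    exact h₂ ▸ hI d hq
  exact hfI (hle (hspan ▸ Ideal.mem_sup_right (Ideal.mem_span_singleton_self f)))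

theorem isHomogeneous_sq_exampleIdeal :
    (exampleIdeal ^ 2).IsHomogeneous (homogeneousSubmodule (Fin 7) ℚ) := by
  have h : exampleIdeal.IsHomogeneous (homogeneousSubmodule (Fin 7) ℚ) := by
    rw [← span_range_exampleGenerator]
    refine Ideal.homogeneous_span _ _ ?_
    rintro _ ⟨i, rfl⟩
    exact ⟨4, isHomogeneous_exampleGenerator i⟩
  rw [sq]
  exact h.mul h

theorem mainTheorem10 :
    exampleIdeal.IsRadical ∧
    IsBinomialIdeal exampleIdeal ∧
    IsCohenMacaulayRing (MvPolynomial (Fin 7) ℚ ⧸ exampleIdeal) ∧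
    exampleIdeal.height = 2 ∧
    IsGeneratedInDegree exampleIdeal 4 ∧
    symbolicPower exampleIdeal 2 = exampleIdeal ^ 2 ⊔ Ideal.span {exampleForm} ∧
    exampleForm.IsHomogeneous 9 ∧
    IsMinimalGenerator exampleForm (symbolicPower exampleIdeal 2) ∧
    ¬ IsGeneratedInDegreesLE (symbolicPower exampleIdeal 2) (2 * 4) := by
  refine ⟨isRadical_exampleIdeal, isBinomialIdeal_exampleIdeal,
    isCohenMacaulayRing_quotient_exampleIdeal, height_exampleIdeal,
    isGeneratedInDegree_exampleIdeal, symbolicPower_exampleIdeal_two, isHomogeneous_exampleForm,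
    isMinimalGenerator_exampleForm, ?_⟩
  rw [symbolicPower_exampleIdeal_two]
  exact not_isGeneratedInDegreesLE_sup_span_singleton isHomogeneous_sq_exampleIdeal
    isHomogeneous_exampleForm exampleForm_notMem_sq_exampleIdeal (by norm_num)
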